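/- Let $\mathbb F_q$ be a finite field with $q$ elements and let $m\ge 2$ be an odd integer. Let $$HRM_q(2,m)=\{(f(x))_{x\in\mathbb F_q^m} : f\in\mathbb F_q[x_1,\dots,x_m]\text{ is zero or homogeneous of degree }2\}\subseteq \mathbb F_q^{\,n},\qquad n=q^m,$$ be the second order homogeneous Reed–Muller code. For $0\le w\le n$ let $A_w$ be the number of codewords of $HRM_q(2,m)$ with exactly $w$ nonzero coordinates, and let $a_0,a_1,\dots,a_N$ be the subsequence of $A_0,A_1,\dots,A_n$ consisting of its nonzero terms, in the same order. Then $HRM_q(2,m)$ is log-concave, that is, $a_i^2\ge a_{i-1}a_{i+1}$ for all $1\le i\le N-1$. -/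

import Mathlib

/-- The number of codewords of Hamming weight `w` in the linear code `C` over `F`
(coordinates indexed by a finite type `ι`). -/
noncomputable def weightCount {F ι : Type*} [Field F] [DecidableEq F] [Fintype ι]
    (C : Submodule F (ι → F)) (w : ℕ) : ℕ :=
  Set.ncard {c : ι → F | c ∈ C ∧ hammingNorm c = w}

/-- The weight distribution `A_0, A_1, …, A_n` of a code of length `n`. -/
noncomputable def weightDistribution {F ι : Type*} [Field F] [DecidableEq F] [Fintype ι]
    (C : Submodule F (ι → F)) : List ℕ :=
  (List.range (Fintype.card ι + 1)).map (weightCount C)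

/-- The nonzero weight distribution: the subsequence of the nonzero terms of `A_0, …, A_n`. -/
noncomputable def nonzeroWeightDistribution {F ι : Type*} [Field F] [DecidableEq F] [Fintype ι]
    (C : Submodule F (ι → F)) : List ℕ :=
  (weightDistribution C).filter (fun a => a ≠ 0)

/-- A finite sequence `a_0, …, a_n` of real numbers is log-concave if
`a_i ^ 2 ≥ a_{i-1} * a_{i+1}` for all `1 ≤ i ≤ n - 1`. -/
def IsLogConcaveSeq (a : List ℝ) : Prop :=
  ∀ (i : ℕ) (h : i + 2 < a.length), a[i] * a[i + 2] ≤ a[i + 1] ^ 2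

/-- A linear code is log-concave if its nonzero weight distribution is. -/
def IsLogConcaveCode {F ι : Type*} [Field F] [DecidableEq F] [Fintype ι]
    (C : Submodule F (ι → F)) : Prop :=
  IsLogConcaveSeq ((nonzeroWeightDistribution C).map (fun a : ℕ => (a : ℝ)))

/-- Evaluation of polynomials in `m` variables at all the points of `F ^ m`. -/
noncomputable def evalAllPoints (F : Type*) [Field F] (m : ℕ) :
    MvPolynomial (Fin m) F →ₗ[F] ((Fin m → F) → F) :=
  LinearMap.pi fun x => (MvPolynomial.aeval x : MvPolynomial (Fin m) F →ₐ[F] F).toLinearMap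

/-- The homogeneous Reed–Muller code of order `r` in `m` variables over `F`: the evaluation
vectors `(f(x))_{x ∈ F ^ m}` of the homogeneous polynomials `f` of degree `r`, zero included. -/
noncomputable def homogeneousReedMuller (F : Type*) [Field F] (r m : ℕ) :
    Submodule F ((Fin m → F) → F) :=
  (MvPolynomial.homogeneousSubmodule (Fin m) F r).map (evalAllPoints F m)

/-! Homogeneous polynomials of degree two induce exactly the quadratic forms, so the code is the
space of quadratic forms on `F ^ m`, m = 2k + 1, and a weight is q^m minus a number of zeros.
Splitting off singular radical vectors and hyperbolic planes leaves an anisotropic form, of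
dimension at most two by Chevalley–Warning. Hence (`quadraticForm_classification`) rank 2h of plus
or minus type gives q^(m-1) ± (q-1) q^(m-h-1) zeros, and every odd rank gives q^(m-1). In order of
increasing weight this is: plus type with h = 0, …, k, then all odd ranks together, then minus type
with h = k, …, 1.

The frequencies come from double counting forms together with a nonzero singular vector, inside the
radical (`formCount_radical`) or outside it (`formCount_singular`). The forms of rank 2h number
`evenRankCount`, a product of explicit ratios `rankFactor`, and split between the two types as (q^h
+ 1) : (q^h - 1). The middle term is what remains of the q^(m(m+1)/2) forms.

Log-concavity on each branch holds because `rankFactor` drops at least fourfold at each step, which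
absorbs the sign corrections. Near the middle it is enough that the odd-rank count lies between E/2
and 2qE, where E is `evenRankCount` at h = k. No step divides by 2 in `F`, so characteristic 2 needs
no separate treatment. -/

section BlockForms

/-! ### Quadratic forms with a split-off radical line or hyperbolic plane. -/

variable {F W V V' : Type*} [Field F] [AddCommGroup W] [Module F W] [AddCommGroup V] [Module F V]
  [AddCommGroup V'] [Module F V']

/-- The number of zeros of a quadratic form. -/
noncomputable def zeroCount (Q : QuadraticForm F V) : ℕ :=
  Nat.card {v : V // Q v = 0}

/-- The number of singular vectors in the radical of the polar form of a quadratic form. -/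
noncomputable def radCount (Q : QuadraticForm F V) : ℕ :=
  Nat.card {v : V // Q v = 0 ∧ ∀ w, QuadraticMap.polar Q v w = 0}

theorem polar_comp_equiv (Q : QuadraticForm F V) (e : V' ≃ₗ[F] V) (v w : V') :
    QuadraticMap.polar (Q.comp e.toLinearMap) v w = QuadraticMap.polar Q (e v) (e w) := by
  simp [QuadraticMap.polar]

theorem zeroCount_comp (Q : QuadraticForm F V) (e : V' ≃ₗ[F] V) :
    zeroCount (Q.comp e.toLinearMap) = zeroCount Q :=
  Nat.card_congr (e.toEquiv.subtypeEquiv fun v => by simp)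

theorem radCount_comp (Q : QuadraticForm F V) (e : V' ≃ₗ[F] V) :
    radCount (Q.comp e.toLinearMap) = radCount Q :=
  Nat.card_congr (e.toEquiv.subtypeEquiv fun v => by
    simp only [polar_comp_equiv, QuadraticMap.comp_apply]
    exact and_congr Iff.rfl ⟨fun h w => by simpa using h (e.symm w), fun h w => h (e w)⟩)

/-- Precomposition with a linear equivalence as a bijection of quadratic forms. -/
def compEquiv (e : V' ≃ₗ[F] V) : QuadraticForm F V ≃ QuadraticForm F V' where
  toFun Q := Q.comp e.toLinearMap
  invFun Q := Q.comp e.symm.toLinearMap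
  left_inv Q := by ext; simp
  right_inv Q := by ext; simp

/-- The quadratic form `(t, w) ↦ a t ^ 2 + t L(w) + Q(w)` on `F × W`. -/
def extForm (a : F) (L : Module.Dual F W) (Q : QuadraticForm F W) : QuadraticForm F (F × W) :=
  a • QuadraticMap.linMulLin (LinearMap.fst F F W) (LinearMap.fst F F W)
    + QuadraticMap.linMulLin (LinearMap.fst F F W) (L ∘ₗ LinearMap.snd F F W)
    + Q.comp (LinearMap.snd F F W)

theorem extForm_apply (a : F) (L : Module.Dual F W) (Q : QuadraticForm F W) (p : F × W) :
    extForm a L Q p = a * (p.1 * p.1) + p.1 * L p.2 + Q p.2 := by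
  simp [extForm]

theorem polar_extForm (a : F) (L : Module.Dual F W) (Q : QuadraticForm F W) (p r : F × W) :
    QuadraticMap.polar (extForm a L Q) p r =
      2 * a * p.1 * r.1 + p.1 * L r.2 + r.1 * L p.2 + QuadraticMap.polar Q p.2 r.2 := by
  simp only [QuadraticMap.polar, extForm_apply, Prod.fst_add, Prod.snd_add, map_add]
  ring

theorem apply_prod (Q : QuadraticForm F (F × W)) (t : F) (w : W) :
    Q (t, w) = Q (1, 0) * (t * t) + t * QuadraticMap.polar Q (1, 0) (0, w) + Q (0, w) := by
  have h : (t, w) = t • ((1, 0) : F × W) + (0, w) := by simp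
  rw [h, QuadraticMap.map_add Q, QuadraticMap.polar_smul_left, QuadraticMap.map_smul]
  simp only [smul_eq_mul]
  ring

/-- A quadratic form on `F × W` is determined by a scalar, a linear form and a quadratic form
on `W`. -/
def extEquiv : F × Module.Dual F W × QuadraticForm F W ≃ QuadraticForm F (F × W) where
  toFun x := extForm x.1 x.2.1 x.2.2
  invFun Q := (Q (1, 0), Q.polarBilin (1, 0) ∘ₗ LinearMap.inr F F W, Q.comp (LinearMap.inr F F W))
  left_inv := by
    rintro ⟨a, L, Q⟩
    refine Prod.ext ?_ (Prod.ext ?_ ?_)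
    · simp [extForm_apply]
    · ext w
      simp [polar_extForm]
    · ext w
      simp [extForm_apply]
  right_inv Q := by
    ext ⟨t, w⟩
    rw [apply_prod Q t w]
    simp [extForm_apply]

theorem eq_extForm (Q : QuadraticForm F (F × W)) (a : F) (L : Module.Dual F W)
    (ha : Q (1, 0) = a) (hL : ∀ w, QuadraticMap.polar Q (1, 0) (0, w) = L w) :
    Q = extForm a L (Q.comp (LinearMap.inr F F W)) := by
  ext ⟨t, w⟩
  rw [apply_prod Q t w]
  simp [extForm_apply, ha, hL]

theorem zeroCount_extForm_zero [Finite F] (Q : QuadraticForm F W) :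
    zeroCount (extForm 0 0 Q) = Nat.card F * zeroCount Q := by
  rw [zeroCount, zeroCount, ← Nat.card_prod]
  exact Nat.card_congr
    { toFun := fun p => (p.1.1, ⟨p.1.2, by simpa [extForm_apply] using p.2⟩)
      invFun := fun p => ⟨(p.1, p.2.1), by simpa [extForm_apply] using p.2.2⟩
      left_inv := fun p => rfl
      right_inv := fun p => rfl }

theorem radCount_extForm_zero [Finite F] (Q : QuadraticForm F W) :
    radCount (extForm 0 0 Q) = Nat.card F * radCount Q := by
  rw [radCount, radCount, ← Nat.card_prod]
  exact Nat.card_congr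
    { toFun := fun p => (p.1.1, ⟨p.1.2, by
        have h := p.2
        simp only [extForm_apply, polar_extForm] at h
        exact ⟨by simpa using h.1, fun w => by simpa using h.2 (0, w)⟩⟩)
      invFun := fun p => ⟨(p.1, p.2.1), by
        simp only [extForm_apply, polar_extForm]
        exact ⟨by simpa using p.2.2.1, fun w => by simpa using p.2.2.2 w.2⟩⟩
      left_inv := fun p => rfl
      right_inv := fun p => rfl }

/-- The quadratic form `(s, t, w) ↦ s t + a t ^ 2 + t L(w) + Q(w)` on `F × F × W`. -/
def hypForm (a : F) (L : Module.Dual F W) (Q : QuadraticForm F W) : QuadraticForm F (F × F × W) :=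
  extForm 0 (LinearMap.fst F F W) (extForm a L Q)

theorem hypForm_apply (a : F) (L : Module.Dual F W) (Q : QuadraticForm F W) (s t : F) (w : W) :
    hypForm a L Q (s, t, w) = s * t + (a * (t * t) + t * L w + Q w) := by
  simp [hypForm, extForm_apply]

/-- If t = 0, then s is free and w must be a zero of `Q`; if t ≠ 0, then w is free and the equation,
linear in s, has one solution. -/
theorem zeroCount_hypForm [Finite F] [Finite W] (a : F) (L : Module.Dual F W)
    (Q : QuadraticForm F W) :
    zeroCount (hypForm a L Q) = Nat.card F * zeroCount Q + (Nat.card F - 1) * Nat.card W := by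
  classical
  have h1 : Nat.card F - 1 = Nat.card {t : F // t ≠ 0} := by
    have := Fintype.ofFinite F
    rw [Nat.card_eq_fintype_card, Nat.card_eq_fintype_card, Fintype.card_subtype_compl]
    simp
  rw [zeroCount, zeroCount, h1, ← Nat.card_prod, ← Nat.card_prod, ← Nat.card_sum]
  exact Nat.card_congr
    { toFun := fun p => if h : p.1.2.1 = 0
        then Sum.inl (p.1.1, ⟨p.1.2.2, by
          have := p.2
          obtain ⟨⟨s, t, w⟩, hp⟩ := p
          simp only at h
          subst h
          simpa [hypForm_apply] using hp⟩)
        else Sum.inr (⟨p.1.2.1, h⟩, p.1.2.2)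
      invFun := fun x => match x with
        | Sum.inl (s, w) => ⟨(s, 0, w.1), by simp [hypForm_apply, w.2]⟩
        | Sum.inr (t, w) => ⟨(-(a * (t.1 * t.1) + t.1 * L w + Q w) / t.1, t.1, w), by
            rw [hypForm_apply, div_mul_cancel₀ _ t.2]; ring⟩
      left_inv := by
        rintro ⟨⟨s, t, w⟩, hp⟩
        by_cases h : t = 0
        · subst h
          simp
        · have : -(a * (t * t) + t * L w + Q w) / t = s := by
            rw [div_eq_iff h]
            rw [hypForm_apply] at hp
            linear_combination -hp
          simp only [h, dite_false, this]
      right_inv := by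
        rintro (⟨s, w⟩ | ⟨t, w⟩)
        · simp
        · simp [t.2] }

/-- Orthogonality to the first two basis vectors forces t = 0 and s = -L(w), so projection to w
identifies the two sets of singular radical vectors. -/
theorem radCount_hypForm (a : F) (L : Module.Dual F W) (Q : QuadraticForm F W) :
    radCount (hypForm a L Q) = radCount Q := by
  have hmem (w : {w // Q w = 0 ∧ ∀ w', QuadraticMap.polar Q w w' = 0}) :
      hypForm a L Q (-L w.1, 0, w.1) = 0 ∧
        ∀ p, QuadraticMap.polar (hypForm a L Q) (-L w.1, 0, w.1) p = 0 := by
    obtain ⟨w, h, hw⟩ := w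
    refine ⟨by simp [hypForm_apply, h], ?_⟩
    rintro ⟨s, t, w'⟩
    simp [hypForm, polar_extForm, hw]
    ring
  refine (Nat.card_congr (Equiv.ofBijective (fun w => ⟨_, hmem w⟩) ⟨?_, ?_⟩)).symm
  · intro w w' h
    simp only [Subtype.mk.injEq, Prod.mk.injEq] at h
    exact Subtype.ext h.2.2
  · rintro ⟨⟨s, t, w⟩, h, hw⟩
    have ht : t = 0 := by simpa [hypForm, polar_extForm] using hw (1, 0, 0)
    subst ht
    have hs : s + L w = 0 := by simpa [hypForm, polar_extForm] using hw (0, 1, 0)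
    have hs' : -L w = s := by linear_combination -hs
    exact ⟨⟨w, by simpa [hypForm_apply] using h,
      fun w' => by simpa [hypForm, polar_extForm] using hw (0, 0, w')⟩, by simp [hs']⟩

/-- The values of a form and of its polar at one singular vector fix only the `s` part; the scalar,
the linear form and the form on `W` stay free, which is the multiplicity in `formCount_singular`. -/
theorem eq_hypForm (Q : QuadraticForm F (F × F × W)) (h0 : Q (1, 0, 0) = 0)
    (h : ∀ p, QuadraticMap.polar Q (1, 0, 0) p = p.2.1) :
    ∃ a L Q', Q = hypForm (W := W) a L Q' := by
  have h1 := eq_extForm Q 0 (LinearMap.fst F F W) h0 (fun w => h (0, w))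
  obtain ⟨⟨a, L, Q'⟩, hx⟩ := extEquiv.surjective (Q.comp (LinearMap.inr F F (F × W)))
  exact ⟨a, L, Q', by rw [h1, ← hx]; rfl⟩

theorem hypForm_isotropic (a : F) (L : Module.Dual F W) (Q : QuadraticForm F W) :
    hypForm a L Q (1, 0, 0) = 0 ∧
      ∀ p, QuadraticMap.polar (hypForm a L Q) (1, 0, 0) p = p.2.1 := by
  refine ⟨by simp [hypForm_apply], fun p => by simp [hypForm, polar_extForm]⟩

theorem hypForm_injective {a a' : F} {L L' : Module.Dual F W} {Q Q' : QuadraticForm F W}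
    (h : hypForm a L Q = hypForm a' L' Q') : a = a' ∧ L = L' ∧ Q = Q' := by
  have h1 := extEquiv.injective (a₁ := (0, LinearMap.fst F F W, extForm a L Q))
    (a₂ := (0, LinearMap.fst F F W, extForm a' L' Q')) h
  have h2 := extEquiv.injective (a₁ := (a, L, Q)) (a₂ := (a', L', Q'))
    (congrArg (fun x => x.2.2) h1)
  simpa using h2

/-- A nonzero vector is the first basis vector of some decomposition `V ≃ F × W`. -/
theorem exists_equiv_prod_of_ne_zero [FiniteDimensional F V] [FiniteDimensional F W]
    (hVW : Module.finrank F V = Module.finrank F W + 1) {v : V} (hv : v ≠ 0) :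
    ∃ e : V ≃ₗ[F] F × W, e v = (1, 0) := by
  obtain ⟨C, hC⟩ := Submodule.exists_isCompl (Submodule.span F {v})
  have hd := Submodule.finrank_add_eq_of_isCompl hC
  rw [finrank_span_singleton hv] at hd
  have e2 : C ≃ₗ[F] W := LinearEquiv.ofFinrankEq _ _ (by omega)
  let e1 := (LinearEquiv.toSpanNonzeroSingleton F V v hv).symm
  refine ⟨(Submodule.prodEquivOfIsCompl _ _ hC).symm ≪≫ₗ e1.prodCongr e2, ?_⟩
  have h := Submodule.prodEquivOfIsCompl_symm_apply_left _ _ hC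
    (⟨v, Submodule.mem_span_singleton_self v⟩ : Submodule.span F {v})
  have h1 : e1 ⟨v, Submodule.mem_span_singleton_self v⟩ = 1 := by
    rw [LinearEquiv.symm_apply_eq]
    ext
    simp
  simp [h, h1]

/-- A nonzero linear form is the first coordinate of some decomposition `V ≃ F × W`. -/
theorem exists_equiv_prod_of_dual_ne_zero [FiniteDimensional F V] [FiniteDimensional F W]
    (hVW : Module.finrank F V = Module.finrank F W + 1) {l : Module.Dual F V} (hl : l ≠ 0) :
    ∃ e : V ≃ₗ[F] F × W, ∀ v, (e v).1 = l v := by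
  have hr := Module.Dual.range_eq_top_of_ne_zero hl
  have hd := LinearMap.finrank_range_add_finrank_ker l
  rw [hr, finrank_top, Module.finrank_self] at hd
  have e2 : LinearMap.ker l ≃ₗ[F] W := LinearEquiv.ofFinrankEq _ _ (by omega)
  obtain ⟨C, hC⟩ := Submodule.exists_isCompl (LinearMap.ker l)
  obtain ⟨g, hg⟩ := LinearMap.exists_leftInverse_of_injective (LinearMap.ker l).subtype
    (LinearMap.ker l).ker_subtype
  have hgr : LinearMap.range g = ⊤ := LinearMap.range_eq_top.2 fun x =>
    ⟨x, by simpa using LinearMap.congr_fun hg x⟩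
  refine ⟨LinearMap.equivProdOfSurjectiveOfIsCompl l (e2.toLinearMap ∘ₗ g) hr ?_ ?_, fun v => rfl⟩
  · rw [LinearMap.range_comp, hgr]
    simp
  · have : LinearMap.ker (e2.toLinearMap ∘ₗ g) = LinearMap.ker g := by
      ext; simp
    rw [this]
    exact (LinearMap.isCompl_of_proj fun x => by simpa using LinearMap.congr_fun hg x)

/-- As v lies in the kernel of l, one may take l as a coordinate first and then complete v to a
basis of the kernel; a swap of the two coordinates puts v in front. -/
theorem exists_equiv_hyperbolic [FiniteDimensional F V] [FiniteDimensional F W]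
    (hVW : Module.finrank F V = Module.finrank F W + 2) {v : V} {l : Module.Dual F V}
    (hv : v ≠ 0) (hl : l ≠ 0) (hlv : l v = 0) :
    ∃ e : V ≃ₗ[F] F × F × W, e v = (1, 0, 0) ∧ ∀ x, (e x).2.1 = l x := by
  obtain ⟨e1, h1⟩ := exists_equiv_prod_of_dual_ne_zero (W := F × W)
    (by rw [hVW, Module.finrank_prod, Module.finrank_self]; ring) hl
  have hne : (e1 v).2 ≠ 0 := fun h => hv (e1.injective (Prod.ext (by simp [h1, hlv]) (by simp [h])))
  obtain ⟨e2, h2⟩ := exists_equiv_prod_of_ne_zero (F := F) (W := W)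
    (by rw [Module.finrank_prod, Module.finrank_self]; ring) hne
  let s : (F × F × W) ≃ₗ[F] (F × F × W) :=
    { toFun := fun p => (p.2.1, p.1, p.2.2)
      invFun := fun p => (p.2.1, p.1, p.2.2)
      left_inv := fun p => rfl
      right_inv := fun p => rfl
      map_add' := fun p r => rfl
      map_smul' := fun c p => rfl }
  refine ⟨e1 ≪≫ₗ (LinearEquiv.refl F F).prodCongr e2 ≪≫ₗ s, ?_, fun x => ?_⟩
  · simp [s, h2, h1, hlv]
  · simp [s, h1]

end BlockForms

/-! ### Double counting of forms with singular vectors. -/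

section FormCount

variable {F W V V' : Type*} [Field F] [Finite F] [AddCommGroup W] [Module F W] [AddCommGroup V]
  [Module F V] [AddCommGroup V'] [Module F V']

/-- The number of quadratic forms on `V` with `d` singular radical vectors and `z` zeros. -/
noncomputable def formCount (F V : Type*) [Field F] [AddCommGroup V] [Module F V] (d z : ℕ) : ℕ :=
  Nat.card {Q : QuadraticForm F V // radCount Q = d ∧ zeroCount Q = z}

instance finite_quadraticForm [Finite V] : Finite (QuadraticForm F V) :=
  DFunLike.finite _

instance finite_dual [Finite V] : Finite (Module.Dual F V) :=
  DFunLike.finite _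

/-- Double counting for a relation that is regular on both sides. -/
theorem card_mul_eq_card_mul_of_regular {α β : Type*} [Finite α] [Finite β] (r : α → β → Prop)
    {k l : ℕ} (hk : ∀ a, Nat.card {b // r a b} = k) (hl : ∀ b, Nat.card {a // r a b} = l) :
    Nat.card α * k = Nat.card β * l := by
  have := Fintype.ofFinite α
  have := Fintype.ofFinite β
  have h1 : Nat.card (Σ a, {b // r a b}) = Nat.card α * k := by
    rw [Nat.card_sigma, Finset.sum_congr rfl fun a _ => hk a]
    simp
  have h2 : Nat.card (Σ b, {a // r a b}) = Nat.card β * l := by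
    rw [Nat.card_sigma, Finset.sum_congr rfl fun b _ => hl b]
    simp
  rw [← h1, ← h2]
  exact Nat.card_congr
    { toFun := fun x => ⟨x.2.1, x.1, x.2.2⟩
      invFun := fun x => ⟨x.2.1, x.1, x.2.2⟩
      left_inv := fun x => rfl
      right_inv := fun x => rfl }

theorem card_and_not {α : Type*} [Finite α] (p q : α → Prop) (h : ∀ a, q a → p a) :
    Nat.card {a // p a ∧ ¬ q a} = Nat.card {a // p a} - Nat.card {a // q a} := by
  classical
  have := Fintype.ofFinite α
  simp only [Nat.card_eq_fintype_card, Fintype.card_subtype]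
  rw [← Finset.card_sdiff_of_subset (Finset.monotone_filter_right _ fun a _ => h a)]
  congr 1
  ext a
  simp

theorem card_ne (α : Type*) [Finite α] (a : α) : Nat.card {x : α // x ≠ a} = Nat.card α - 1 := by
  have h := card_and_not (fun _ : α => True) (fun x => x = a) (fun _ _ => trivial)
  simp only [true_and] at h
  rw [h, Nat.card_congr (Equiv.subtypeUnivEquiv fun _ => trivial)]
  simp

theorem card_dual_eq [Finite V] : Nat.card (Module.Dual F V) = Nat.card V := by
  have := Fintype.ofFinite F
  rw [Module.natCard_eq_pow_finrank (K := F), Module.natCard_eq_pow_finrank (K := F) (V := V),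
    Subspace.dual_finrank_eq]

theorem two_le_card (F : Type*) [Field F] [Finite F] : 2 ≤ Nat.card F :=
  Finite.one_lt_card

/-- Quadratic forms together with a nonzero vector of the radical. -/
theorem formCount_radical [Finite V] [Finite W]
    (hVW : Module.finrank F V = Module.finrank F W + 1) (d z : ℕ) :
    formCount F V (Nat.card F * d) (Nat.card F * z) * (Nat.card F * d - 1) =
      (Nat.card V - 1) * formCount F W d z := by
  have hq := two_le_card F
  rw [← card_ne V 0, formCount]
  refine card_mul_eq_card_mul_of_regular
    (fun Q v => Q.1 v.1 = 0 ∧ ∀ w, QuadraticMap.polar Q.1 v.1 w = 0) (fun Q => ?_) (fun v => ?_)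
  · obtain ⟨Q, hd, hz⟩ := Q
    -- Only nonzero radical vectors are counted, so the zero vector is removed; this is the -1 on
    -- the left side.
    have h := card_and_not (fun v => Q v = 0 ∧ ∀ w, QuadraticMap.polar Q v w = 0)
      (fun v => v = 0) (by rintro _ rfl; simp)
    have h1 : Nat.card {v : V // v = 0} = 1 := by simp
    have h2 : Nat.card {v // Q v = 0 ∧ ∀ w, QuadraticMap.polar Q v w = 0} = _ := hd
    rw [h1, h2] at h
    rw [← h]
    exact Nat.card_congr
      { toFun := fun x => ⟨x.1.1, x.2, x.1.2⟩
        invFun := fun x => ⟨⟨x.1, x.2.2⟩, x.2.1⟩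
        left_inv := fun x => rfl
        right_inv := fun x => rfl }
  · obtain ⟨v, hv⟩ := v
    obtain ⟨e, he⟩ := exists_equiv_prod_of_ne_zero hVW hv
    have hev : ∀ Q' : QuadraticForm F W, (extForm 0 0 Q').comp e.toLinearMap v = 0 ∧
        ∀ w, QuadraticMap.polar ((extForm 0 0 Q').comp e.toLinearMap) v w = 0 := fun Q' => by
      simp [polar_comp_equiv, polar_extForm, extForm_apply, he]
    refine (Nat.card_congr (Equiv.ofBijective
      (fun Q' : {Q : QuadraticForm F W // radCount Q = d ∧ zeroCount Q = z} =>
        (⟨⟨(extForm 0 0 Q'.1).comp e.toLinearMap, ?_⟩, hev Q'.1⟩ :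
        {Q : {Q : QuadraticForm F V // radCount Q = Nat.card F * d ∧ zeroCount Q = Nat.card F * z} //
          Q.1 v = 0 ∧ ∀ w, QuadraticMap.polar Q.1 v w = 0})) ⟨?_, ?_⟩)).symm
    · rw [radCount_comp, zeroCount_comp, radCount_extForm_zero, zeroCount_extForm_zero, Q'.2.1,
        Q'.2.2]
      exact ⟨rfl, rfl⟩
    · intro Q Q' h
      have h1 := (compEquiv e).injective (congrArg (fun x => x.1.1) h)
      have h2 := extEquiv.injective (a₁ := (0, 0, Q.1)) (a₂ := (0, 0, Q'.1)) h1
      simpa [Subtype.ext_iff] using h2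
    · rintro ⟨⟨Q, hd, hz⟩, h0, h⟩
      obtain ⟨Q, rfl⟩ := (compEquiv e).surjective Q
      simp only [compEquiv, Equiv.coe_fn_mk, QuadraticMap.comp_apply, LinearEquiv.coe_coe, he,
        polar_comp_equiv, radCount_comp, zeroCount_comp] at h0 h hd hz
      have hQ := eq_extForm Q 0 0 h0 (fun w => by simpa using h (e.symm (0, w)))
      rw [hQ, radCount_extForm_zero] at hd
      rw [hQ, zeroCount_extForm_zero] at hz
      exact ⟨⟨_, Nat.eq_of_mul_eq_mul_left (by omega) hd, Nat.eq_of_mul_eq_mul_left (by omega) hz⟩,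
        Subtype.ext (Subtype.ext (congrArg (compEquiv e) hQ.symm))⟩

/-- Functionals vanishing at v are the functionals on a complement of its span, hence q^n of them,
with zero excluded. -/
theorem card_dual_annihilator [Finite V] {n : ℕ} (hV : Module.finrank F V = n + 1) {v : V}
    (hv : v ≠ 0) : Nat.card {l : Module.Dual F V // l ≠ 0 ∧ l v = 0} = Nat.card F ^ n - 1 := by
  have := Fintype.ofFinite F
  obtain ⟨e, he⟩ := exists_equiv_prod_of_ne_zero (F := F) (V := V) (W := Fin n → F) (by simp [hV]) hv
  have hc : Nat.card {l : Module.Dual F V // l v = 0} = Nat.card F ^ n := by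
    have : Nat.card (Module.Dual F (Fin n → F)) = Nat.card F ^ n := by
      rw [card_dual_eq]; simp
    rw [← this]
    exact Nat.card_congr
      { toFun := fun l => l.1 ∘ₗ e.symm.toLinearMap ∘ₗ LinearMap.inr F F _
        invFun := fun l => ⟨l ∘ₗ LinearMap.snd F F _ ∘ₗ e.toLinearMap, by simp [he]⟩
        left_inv := fun l => by
          ext x
          have hx : e x = (e x).1 • e v + (0, (e x).2) := by simp [he]
          have hx' : x = (e x).1 • v + e.symm (0, (e x).2) := by
            apply e.injective
            rw [map_add, map_smul, e.apply_symm_apply, ← hx]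
          have : l.1 x = l.1 (e.symm (0, (e x).2)) := by
            conv_lhs => rw [hx']
            rw [map_add, map_smul, l.2]
            simp
          simp [this]
        right_inv := fun l => by ext x; simp }
  have h := card_and_not (fun l : Module.Dual F V => l v = 0) (fun l => l = 0)
    (by rintro _ rfl; simp)
  rw [hc] at h
  have h1 : Nat.card {l : Module.Dual F V // l = 0} = 1 := by simp
  rw [h1] at h
  rw [← h]
  exact Nat.card_congr (Equiv.subtypeEquivRight fun l => and_comm)

theorem card_isotropic_pairs [Finite V] {n : ℕ} (hV : Module.finrank F V = n + 1) :
    Nat.card {p : V × Module.Dual F V // p.1 ≠ 0 ∧ p.2 ≠ 0 ∧ p.2 p.1 = 0} =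
      (Nat.card V - 1) * (Nat.card F ^ n - 1) := by
  have := Fintype.ofFinite {v : V // v ≠ 0}
  have h : Nat.card (Σ v : {v : V // v ≠ 0}, {l : Module.Dual F V // l ≠ 0 ∧ l v.1 = 0}) =
      (Nat.card V - 1) * (Nat.card F ^ n - 1) := by
    rw [Nat.card_sigma, Finset.sum_congr rfl fun v _ => card_dual_annihilator hV v.2,
      Finset.sum_const, Finset.card_univ, ← Nat.card_eq_fintype_card, card_ne, smul_eq_mul]
  rw [← h]
  exact Nat.card_congr
    { toFun := fun x => ⟨⟨x.1.1, x.2.1⟩, x.1.2, x.2.2⟩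
      invFun := fun x => ⟨(x.1.1, x.2.1), x.1.2, x.2.2⟩
      left_inv := fun x => rfl
      right_inv := fun x => rfl }

/-- Quadratic forms together with a singular vector outside the radical. -/
theorem formCount_singular [Finite V] [Finite W]
    (hVW : Module.finrank F V = Module.finrank F W + 2) (d z : ℕ) :
    formCount F V d (Nat.card F * z + (Nat.card F - 1) * Nat.card W) *
        (Nat.card F * z + (Nat.card F - 1) * Nat.card W - d) =
      (Nat.card V - 1) * (Nat.card F * Nat.card W - 1) *
        (Nat.card F * Nat.card W * formCount F W d z) := by
  have hq := two_le_card F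
  have hW : Nat.card F * Nat.card W = Nat.card F ^ (Module.finrank F W + 1) := by
    have := Fintype.ofFinite F
    rw [Module.natCard_eq_pow_finrank (K := F) (V := W), pow_succ, mul_comm]
  have hp := card_isotropic_pairs (F := F) (V := V) hVW
  rw [← hW] at hp
  rw [← hp, formCount]
  -- Each form is paired with (v, l), where v is singular and l is its polar functional. Since l ≠
  -- 0, v is outside the radical; l(v) = 0 is automatic because polar(v, v) = 2 Q(v).
  refine card_mul_eq_card_mul_of_regular
    (fun Q p => Q.1 p.1.1 = 0 ∧ ∀ w, QuadraticMap.polar Q.1 p.1.1 w = p.1.2 w)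
    (fun Q => ?_) (fun p => ?_)
  · obtain ⟨Q, hd, hz⟩ := Q
    have h := card_and_not (fun v => Q v = 0)
      (fun v => Q v = 0 ∧ ∀ w, QuadraticMap.polar Q v w = 0) (fun v hv => hv.1)
    have h2 : Nat.card {v // Q v = 0 ∧ ∀ w, QuadraticMap.polar Q v w = 0} = d := hd
    have h3 : Nat.card {v // Q v = 0} = _ := hz
    rw [h2, h3] at h
    rw [← h]
    refine Nat.card_congr (Equiv.ofBijective (fun x => ⟨x.1.1.1, x.2.1, fun hx => ?_⟩) ⟨?_, ?_⟩)
    · refine x.1.2.2.1 (LinearMap.ext fun w => ?_)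
      rw [← x.2.2 w]
      exact hx.2 w
    · rintro ⟨⟨⟨v, l⟩, h1⟩, h2, h3⟩ ⟨⟨⟨v', l'⟩, h1'⟩, h2', h3'⟩ h
      simp only [Subtype.mk.injEq] at h
      subst h
      have : l = l' := LinearMap.ext fun w => by rw [← h3 w, ← h3' w]
      subst this
      rfl
    · rintro ⟨v, h0, hv⟩
      refine ⟨⟨⟨(v, Q.polarBilin v), ?_, ?_, ?_⟩, h0, fun w => rfl⟩, rfl⟩
      · rintro rfl
        exact hv ⟨h0, by simp⟩
      · intro hl
        exact hv ⟨h0, fun w => by simpa using LinearMap.congr_fun hl w⟩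
      · simp [h0]
  · obtain ⟨⟨v, l⟩, hv, hl, hlv⟩ := p
    obtain ⟨e, he, hel⟩ := exists_equiv_hyperbolic hVW hv hl hlv
    rw [mul_assoc (Nat.card F), ← congrArg (· * formCount F W d z) (card_dual_eq (F := F) (V := W)),
      formCount, ← Nat.card_prod, ← Nat.card_prod]
    have hev : ∀ a L, ∀ Q' : QuadraticForm F W, (hypForm a L Q').comp e.toLinearMap v = 0 ∧
        ∀ w, QuadraticMap.polar ((hypForm a L Q').comp e.toLinearMap) v w = l w := fun a L Q' => by
      simp [polar_comp_equiv, he, hypForm_isotropic, hel]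
    refine (Nat.card_congr (Equiv.ofBijective
      (fun x : F × Module.Dual F W × {Q : QuadraticForm F W // radCount Q = d ∧ zeroCount Q = z} =>
        (⟨⟨(hypForm x.1 x.2.1 x.2.2.1).comp e.toLinearMap, ?_⟩, hev _ _ _⟩ :
        {Q : {Q : QuadraticForm F V // radCount Q = d ∧
            zeroCount Q = Nat.card F * z + (Nat.card F - 1) * Nat.card W} //
          Q.1 v = 0 ∧ ∀ w, QuadraticMap.polar Q.1 v w = l w})) ⟨?_, ?_⟩)).symm
    · rw [radCount_comp, zeroCount_comp, radCount_hypForm, zeroCount_hypForm, x.2.2.2.1,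
        x.2.2.2.2]
      exact ⟨rfl, rfl⟩
    · rintro ⟨a, L, Q⟩ ⟨a', L', Q'⟩ h
      have h1 := (compEquiv e).injective (congrArg (fun x => x.1.1) h)
      obtain ⟨h1, h2, h3⟩ := hypForm_injective h1
      simp only at h1 h2 h3
      rw [h1, h2, Subtype.ext h3]
    · rintro ⟨⟨Q, hd, hz⟩, h0, h⟩
      obtain ⟨Q, rfl⟩ := (compEquiv e).surjective Q
      simp only [compEquiv, Equiv.coe_fn_mk, QuadraticMap.comp_apply, LinearEquiv.coe_coe, he,
        polar_comp_equiv, radCount_comp, zeroCount_comp] at h0 h hd hz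
      obtain ⟨a, L, Q', rfl⟩ := eq_hypForm Q h0
        (fun p => by simpa [← hel] using h (e.symm p))
      rw [radCount_hypForm] at hd
      rw [zeroCount_hypForm] at hz
      exact ⟨⟨a, L, Q', hd, Nat.eq_of_mul_eq_mul_left (n := Nat.card F) (by omega)
        (Nat.add_right_cancel hz)⟩, rfl⟩

theorem card_quadraticForm_prod [Finite W] : Nat.card (QuadraticForm F (F × W)) =
    Nat.card F * Nat.card W * Nat.card (QuadraticForm F W) := by
  rw [← Nat.card_congr extEquiv, Nat.card_prod, Nat.card_prod, card_dual_eq, mul_assoc]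

theorem card_fin_fun (α : Type*) (n : ℕ) : Nat.card (Fin n → α) = Nat.card α ^ n := by
  rw [Nat.card_fun, Nat.card_eq_fintype_card (α := Fin n), Fintype.card_fin]

theorem card_quadraticForm (n : ℕ) :
    Nat.card (QuadraticForm F (Fin n → F)) = Nat.card F ^ (n * (n + 1) / 2) := by
  induction n with
  | zero =>
    have : Subsingleton (QuadraticForm F (Fin 0 → F)) := ⟨fun Q Q' => by
      ext x
      rw [Subsingleton.elim x 0, QuadraticMap.map_zero, QuadraticMap.map_zero]⟩
    simp
  | succ n ih =>
    have e : (Fin (n + 1) → F) ≃ₗ[F] F × (Fin n → F) := LinearEquiv.ofFinrankEq _ _ (by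
      simp [add_comm])
    rw [← Nat.card_congr (compEquiv e), card_quadraticForm_prod, ih]
    rw [card_fin_fun, ← pow_succ', ← pow_add]
    congr 1
    have : (n + 1) * (n + 1 + 1) = n * (n + 1) + 2 * (n + 1) := by ring
    omega

end FormCount

/-! ### Homogeneous quadratic polynomials and quadratic forms. -/

section Polynomials

variable {F : Type*} [Field F]

theorem exists_dual_of_mem_homogeneousSubmodule_one {n : ℕ} {f : MvPolynomial (Fin n) F}
    (hf : f ∈ MvPolynomial.homogeneousSubmodule (Fin n) F 1) :
    ∃ l : Module.Dual F (Fin n → F), ∀ x, MvPolynomial.eval x f = l x := by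
  rw [MvPolynomial.homogeneousSubmodule_one_eq_span_X] at hf
  induction hf using Submodule.span_induction with
  | mem f hf =>
    obtain ⟨i, rfl⟩ := hf
    exact ⟨LinearMap.proj i, fun x => by simp⟩
  | zero => exact ⟨0, fun x => by simp⟩
  | add f g _ _ hf hg =>
    obtain ⟨l, hl⟩ := hf
    obtain ⟨l', hl'⟩ := hg
    exact ⟨l + l', fun x => by simp [hl, hl']⟩
  | smul a f _ hf =>
    obtain ⟨l, hl⟩ := hf
    exact ⟨a • l, fun x => by simp [hl, MvPolynomial.smul_eval]⟩

theorem exists_quadraticForm_of_mem_homogeneousSubmodule_two {n : ℕ} {f : MvPolynomial (Fin n) F}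
    (hf : f ∈ MvPolynomial.homogeneousSubmodule (Fin n) F 2) :
    ∃ Q : QuadraticForm F (Fin n → F), ∀ x, MvPolynomial.eval x f = Q x := by
  rw [← MvPolynomial.homogeneousSubmodule_one_pow, pow_two] at hf
  refine Submodule.mul_induction_on hf (fun f hf g hg => ?_) (fun f g hf hg => ?_)
  · obtain ⟨l, hl⟩ := exists_dual_of_mem_homogeneousSubmodule_one hf
    obtain ⟨l', hl'⟩ := exists_dual_of_mem_homogeneousSubmodule_one hg
    exact ⟨QuadraticMap.linMulLin l l', fun x => by simp [hl, hl']⟩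
  · obtain ⟨Q, hQ⟩ := hf
    obtain ⟨Q', hQ'⟩ := hg
    exact ⟨Q + Q', fun x => by simp [hQ, hQ']⟩

theorem exists_homogeneous_of_quadraticForm {n : ℕ} (Q : QuadraticForm F (Fin n → F)) :
    ∃ f ∈ MvPolynomial.homogeneousSubmodule (Fin n) F 2, ∀ x, MvPolynomial.eval x f = Q x := by
  -- The bilinear form need not be symmetric, so this is available in characteristic 2 as well.
  obtain ⟨B, rfl⟩ := LinearMap.BilinMap.toQuadraticMap_surjective Q
  refine ⟨∑ i, ∑ j, MvPolynomial.C (B (Pi.single i 1) (Pi.single j 1)) *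
    (MvPolynomial.X i * MvPolynomial.X j), ?_, fun x => ?_⟩
  · refine Submodule.sum_mem _ fun i _ => Submodule.sum_mem _ fun j _ => ?_
    exact ((MvPolynomial.isHomogeneous_X F i).mul (MvPolynomial.isHomogeneous_X F j)).C_mul _
  · have hx : x = ∑ i, x i • Pi.single i (1 : F) := by
      ext j
      simp [Finset.sum_apply, Pi.single_apply]
    rw [LinearMap.BilinMap.toQuadraticMap_apply]
    conv_rhs => rw [hx]
    simp only [map_sum, LinearMap.sum_apply, map_smul, LinearMap.smul_apply, smul_eq_mul, map_mul,
      MvPolynomial.eval_C, MvPolynomial.eval_X, Finset.mul_sum]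
    rw [Finset.sum_comm]
    refine Finset.sum_congr rfl fun i _ => Finset.sum_congr rfl fun j _ => ?_
    ring

end Polynomials

/-! ### Possible radical sizes and zero counts. -/

section Classification

variable {F : Type*} [Field F] [Finite F]

/-- An anisotropic quadratic form over a finite field has dimension at most two. -/
theorem finrank_le_two_of_anisotropic {n : ℕ} (Q : QuadraticForm F (Fin n → F))
    (hQ : ∀ v, Q v = 0 → v = 0) : n ≤ 2 := by
  classical
  have := Fintype.ofFinite F
  by_contra! hn
  obtain ⟨f, hf, hfQ⟩ := exists_homogeneous_of_quadraticForm Q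
  have hdeg : f.totalDegree < Fintype.card (Fin n) := by
    have := MvPolynomial.IsHomogeneous.totalDegree_le hf
    simp only [Fintype.card_fin]
    omega
  obtain ⟨p, hp⟩ := CharP.exists F
  have hp0 := CharP.char_is_prime F p
  -- Chevalley–Warning: the characteristic divides the number of zeros, which would be 1 for an
  -- anisotropic form.
  have h := char_dvd_card_solutions p hdeg
  have h1 : Fintype.card {x : Fin n → F // MvPolynomial.eval x f = 0} = 1 := by
    rw [Fintype.card_eq_one_iff]
    exact ⟨⟨0, by rw [hfQ, QuadraticMap.map_zero]⟩, fun y => Subtype.ext (hQ _ (by rw [← hfQ]; exact y.2))⟩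
  rw [h1] at h
  exact hp0.one_lt.ne' (Nat.dvd_one.1 h)

/-- Strong induction on the dimension: a singular radical vector raises c by one, a hyperbolic plane
raises h by one, and otherwise the form is anisotropic. The anisotropic plane itself counts towards
h, whence 1 ≤ h for minus type. Multiplying the zero count by q keeps all exponents natural. -/
theorem quadraticForm_classification (n : ℕ) (Q : QuadraticForm F (Fin n → F)) :
    ∃ h c, (n = 2 * h + c ∧ radCount Q = Nat.card F ^ c ∧
        Nat.card F * zeroCount Q = Nat.card F ^ n + (Nat.card F - 1) * Nat.card F ^ (h + c)) ∨
      (1 ≤ h ∧ n = 2 * h + c ∧ radCount Q = Nat.card F ^ c ∧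
        Nat.card F * zeroCount Q + (Nat.card F - 1) * Nat.card F ^ (h + c) = Nat.card F ^ n) ∨
      (n = 2 * h + 1 + c ∧ radCount Q = Nat.card F ^ c ∧
        Nat.card F * zeroCount Q = Nat.card F ^ n) := by
  obtain ⟨s, hs⟩ : ∃ s, Nat.card F = s + 1 := ⟨Nat.card F - 1, by have := two_le_card F; omega⟩
  induction n using Nat.strong_induction_on with
  | _ n ih =>
    by_cases hr : ∃ v, v ≠ 0 ∧ Q v = 0 ∧ ∀ w, QuadraticMap.polar Q v w = 0
    · obtain ⟨v, hv, h0, hp⟩ := hr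
      obtain ⟨k, rfl⟩ : ∃ k, n = k + 1 := by
        cases n with
        | zero => exact absurd (Subsingleton.elim v 0) hv
        | succ k => exact ⟨k, rfl⟩
      obtain ⟨e, he⟩ := exists_equiv_prod_of_ne_zero (F := F) (V := Fin (k + 1) → F)
        (W := Fin k → F) (by simp) hv
      obtain ⟨Q, rfl⟩ := (compEquiv e).surjective Q
      simp only [compEquiv, Equiv.coe_fn_mk, QuadraticMap.comp_apply, LinearEquiv.coe_coe, he,
        polar_comp_equiv, radCount_comp, zeroCount_comp] at h0 hp ⊢
      have hQ := eq_extForm Q 0 0 h0 (fun w => by simpa using hp (e.symm (0, w)))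
      rw [hQ, radCount_extForm_zero, zeroCount_extForm_zero]
      obtain ⟨h, c, H⟩ := ih k (by omega) (Q.comp (LinearMap.inr F F (Fin k → F)))
      refine ⟨h, c + 1, ?_⟩
      rw [hs] at H ⊢
      simp only [Nat.add_sub_cancel] at H ⊢
      rcases H with ⟨h1, h2, h3⟩ | ⟨h1, h2, h3, h4⟩ | ⟨h1, h2, h3⟩
      · left
        refine ⟨by omega, by rw [h2]; ring, by rw [h3]; ring⟩
      · right; left
        refine ⟨h1, by omega, by rw [h3]; ring, ?_⟩
        rw [pow_succ _ k, ← h4]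
        ring
      · right; right
        refine ⟨by omega, by rw [h2]; ring, by rw [h3]; ring⟩
    · by_cases hz : ∃ v, v ≠ 0 ∧ Q v = 0
      · obtain ⟨v, hv, h0⟩ := hz
        have hl : Q.polarBilin v ≠ 0 := fun hl =>
          hr ⟨v, hv, h0, fun w => by simpa using LinearMap.congr_fun hl w⟩
        have hlv : Q.polarBilin v v = 0 := by simp [h0]
        obtain ⟨k, rfl⟩ : ∃ k, n = k + 2 := by
          match n, Q, v, hv, h0, hl, hlv with
          | 0, Q, v, hv, h0, hl, hlv => exact absurd (Subsingleton.elim v 0) hv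
          -- On a line, a nonzero singular vector spans everything and therefore lies in the
          -- radical, against `hl`.
          | 1, Q, v, hv, h0, hl, hlv =>
            obtain ⟨e, he⟩ := exists_equiv_prod_of_ne_zero (F := F) (V := Fin 1 → F)
              (W := Fin 0 → F) (by simp) hv
            refine absurd (LinearMap.ext fun w => ?_) hl
            have hw : w = (e w).1 • v := e.injective (by
              rw [map_smul, he]
              exact Prod.ext (by simp) (Subsingleton.elim _ _))
            rw [hw, map_smul, hlv]
            simp
          | k + 2, _, _, _, _, _, _ => exact ⟨k, rfl⟩
        obtain ⟨e, he, hel⟩ := exists_equiv_hyperbolic (F := F) (V := Fin (k + 2) → F)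
          (W := Fin k → F) (by simp) hv hl hlv
        obtain ⟨Q, rfl⟩ := (compEquiv e).surjective Q
        simp only [compEquiv, Equiv.coe_fn_mk, QuadraticMap.comp_apply, LinearEquiv.coe_coe, he,
          polar_comp_equiv, radCount_comp, zeroCount_comp, QuadraticMap.polarBilin_apply_apply]
          at h0 hel ⊢
        obtain ⟨a, L, Q', rfl⟩ := eq_hypForm Q h0 (fun p => by
          have := hel (e.symm p)
          rw [e.apply_symm_apply] at this
          exact this.symm)
        rw [radCount_hypForm, zeroCount_hypForm]
        obtain ⟨h, c, H⟩ := ih k (by omega) Q'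
        refine ⟨h + 1, c, ?_⟩
        rw [card_fin_fun]
        rw [hs] at H ⊢
        simp only [Nat.add_sub_cancel] at H ⊢
        rcases H with ⟨h1, h2, h3⟩ | ⟨h1, h2, h3, h4⟩ | ⟨h1, h2, h3⟩
        · left
          refine ⟨by omega, h2, by rw [h3]; ring⟩
        · right; left
          refine ⟨by omega, by omega, h3, ?_⟩
          linear_combination (s + 1) * h4
        · right; right
          refine ⟨by omega, h2, by rw [h3]; ring⟩
      · have hQ : ∀ v, Q v = 0 → v = 0 := fun v h => by
          by_contra hv
          exact hz ⟨v, hv, h⟩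
        have hZ : zeroCount Q = 1 := by
          rw [zeroCount, Nat.card_eq_one_iff_exists]
          exact ⟨⟨0, by simp⟩, fun v => Subtype.ext (hQ _ v.2)⟩
        have hR : radCount Q = 1 := by
          rw [radCount, Nat.card_eq_one_iff_exists]
          exact ⟨⟨0, by simp⟩, fun v => Subtype.ext (hQ _ v.2.1)⟩
        rw [hZ, hR, hs]
        have hn := finrank_le_two_of_anisotropic Q hQ
        simp only [Nat.add_sub_cancel]
        interval_cases n
        -- The anisotropic forms of dimensions 0, 1, 2 seed the plus, odd and minus types
        -- respectively.
        · exact ⟨0, 0, Or.inl ⟨rfl, rfl, by ring⟩⟩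
        · exact ⟨0, 0, Or.inr (Or.inr ⟨rfl, rfl, by ring⟩)⟩
        · exact ⟨1, 0, Or.inr (Or.inl ⟨le_rfl, rfl, rfl, by ring⟩)⟩

end Classification

/-! ### Numbers of forms of each even rank and type. -/

section RankCount

/-- The ratio between the numbers of quadratic forms in `n` variables of rank `2 i + 2` and
`2 i`. -/
noncomputable def rankFactor (q : ℝ) (n i : ℕ) : ℝ :=
  (q ^ (n - 2 * i) - 1) * (q ^ (n - 2 * i - 1) - 1) * (q ^ (2 * i + 2) / (q ^ (2 * i + 2) - 1))

/-- The number of quadratic forms in `n` variables of rank `2 h`. -/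
noncomputable def evenRankCount (q : ℝ) (n h : ℕ) : ℝ :=
  ∏ i ∈ Finset.range h, rankFactor q n i

theorem evenRankCount_succ (q : ℝ) (n h : ℕ) :
    evenRankCount q n (h + 1) = evenRankCount q n h * rankFactor q n h :=
  Finset.prod_range_succ _ _

theorem pow_sub_one_pos {q : ℝ} (hq : 1 < q) (n : ℕ) : 0 < q ^ (n + 1) - 1 :=
  sub_pos.2 (one_lt_pow₀ hq (Nat.succ_ne_zero n))

/-- Raising n by 2 shifts the numerator factors by one index, so only the factors at index 0 are
new; the fractions gain their last term. This is the shape of the recursion in `formCount_singular`.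
-/
theorem evenRankCount_add_two {q : ℝ} (hq : 1 < q) (n h : ℕ) :
    evenRankCount q (n + 2) (h + 1) * (q ^ (2 * h + 2) - 1) =
      evenRankCount q n h * ((q ^ (n + 2) - 1) * (q ^ (n + 1) - 1) * q ^ (2 * h + 2)) := by
  simp only [evenRankCount, rankFactor, Finset.prod_mul_distrib]
  rw [Finset.prod_range_succ' (fun i => q ^ (n + 2 - 2 * i) - 1),
    Finset.prod_range_succ' (fun i => q ^ (n + 2 - 2 * i - 1) - 1), Finset.prod_range_succ]
  have h1 : ∀ i, n + 2 - 2 * (i + 1) = n - 2 * i := fun i => by omega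
  simp only [h1, mul_zero, Nat.sub_zero]
  have h2 : n + 2 - 1 = n + 1 := rfl
  have h3 := (pow_sub_one_pos hq (2 * h + 1)).ne'
  rw [h2]
  field_simp

variable {F : Type*} [Field F] [Finite F]

theorem one_lt_card_real (F : Type*) [Field F] [Finite F] : (1 : ℝ) < Nat.card F :=
  Nat.one_lt_cast.2 Finite.one_lt_card

theorem card_fin_fun_sub_one (n : ℕ) :
    ((Nat.card (Fin n → F) - 1 : ℕ) : ℝ) = (Nat.card F : ℝ) ^ n - 1 := by
  rw [Nat.cast_pred Nat.card_pos, card_fin_fun]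
  simp

theorem formCount_singular_real {n d z z' : ℕ}
    (hz : (z' : ℝ) = Nat.card F * z + (Nat.card F - 1) * (Nat.card F : ℝ) ^ n) (hd : d ≤ z') :
    (formCount F (Fin (n + 2) → F) d z' : ℝ) * (z' - d) =
      ((Nat.card F : ℝ) ^ (n + 2) - 1) * ((Nat.card F : ℝ) ^ (n + 1) - 1) *
        ((Nat.card F : ℝ) ^ (n + 1) * formCount F (Fin n → F) d z) := by
  have h := formCount_singular (F := F) (V := Fin (n + 2) → F) (W := Fin n → F) (by simp) d z
  have h1 : z' = Nat.card F * z + (Nat.card F - 1) * Nat.card (Fin n → F) := by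
    have : ((Nat.card F * z + (Nat.card F - 1) * Nat.card (Fin n → F) : ℕ) : ℝ) = z' := by
      rw [hz, card_fin_fun]
      push_cast [Nat.cast_pred (Nat.card_pos (α := F))]
      rfl
    exact_mod_cast this.symm
  rw [← h1] at h
  have h2 := congrArg (Nat.cast (R := ℝ)) h
  have h3 : Nat.card F * Nat.card (Fin n → F) = Nat.card (Fin (n + 1) → F) := by
    rw [card_fin_fun, card_fin_fun, pow_succ']
  rw [h3, Nat.cast_mul, Nat.cast_mul, Nat.cast_mul, Nat.cast_mul, Nat.cast_sub hd,
    card_fin_fun_sub_one, card_fin_fun_sub_one, card_fin_fun] at h2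
  rw [h2]
  push_cast
  rfl

theorem formCount_radical_real (n c z : ℕ) :
    (formCount F (Fin (n + 1) → F) (Nat.card F ^ (c + 1)) (Nat.card F * z) : ℝ) *
        ((Nat.card F : ℝ) ^ (c + 1) - 1) =
      ((Nat.card F : ℝ) ^ (n + 1) - 1) * formCount F (Fin n → F) (Nat.card F ^ c) z := by
  have h := formCount_radical (F := F) (V := Fin (n + 1) → F) (W := Fin n → F) (by simp)
    (Nat.card F ^ c) z
  have h2 := congrArg (Nat.cast (R := ℝ)) h
  have h3 : Nat.card F * Nat.card F ^ c = Nat.card (Fin (c + 1) → F) := by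
    rw [card_fin_fun, pow_succ']
  rw [h3, Nat.cast_mul, Nat.cast_mul, card_fin_fun_sub_one, card_fin_fun_sub_one, card_fin_fun]
    at h2
  exact h2

omit [Finite F] in
theorem zeroCount_eq_card {V : Type*} [AddCommGroup V] [Module F V] [Finite V]
    (Q : QuadraticForm F V) : zeroCount Q = Nat.card V ↔ Q = 0 := by
  constructor
  · intro h
    ext v
    by_contra hv
    have := card_and_not (fun _ : V => True) (fun v => Q v = 0) (fun _ _ => trivial)
    rw [Nat.card_congr (Equiv.subtypeUnivEquiv fun _ => trivial), ← h, zeroCount, Nat.sub_self,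
      Nat.card_eq_zero] at this
    rcases this with h | h
    · exact h.false ⟨v, trivial, hv⟩
    · exact h.not_finite inferInstance
  · rintro rfl
    exact Nat.card_congr (Equiv.subtypeUnivEquiv fun _ => rfl)

omit [Finite F] in
theorem radCount_zero {V : Type*} [AddCommGroup V] [Module F V] :
    radCount (0 : QuadraticForm F V) = Nat.card V :=
  Nat.card_congr (Equiv.subtypeUnivEquiv fun _ => ⟨rfl, fun w => by simp [QuadraticMap.polar]⟩)

theorem formCount_zero_form (n : ℕ) :
    formCount F (Fin n → F) (Nat.card F ^ n) (Nat.card F ^ n) = 1 := by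
  rw [formCount, Nat.card_eq_one_iff_exists]
  rw [← card_fin_fun]
  exact ⟨⟨0, radCount_zero, (zeroCount_eq_card 0).2 rfl⟩,
    fun Q => Subtype.ext ((zeroCount_eq_card Q.1).1 Q.2.2)⟩

/-- Splitting off a hyperbolic plane. The sign `e` is `1` for forms of plus type and `-1` for forms
of minus type. -/
theorem formCount_hyperbolic_plane {e : ℝ} (he : e ^ 2 = 1) {c h z z' : ℕ}
    (hz : (Nat.card F : ℝ) * z =
      (Nat.card F : ℝ) ^ (2 * h + c) + e * (Nat.card F - 1) * (Nat.card F : ℝ) ^ (h + c))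
    (hz' : (Nat.card F : ℝ) * z' = (Nat.card F : ℝ) ^ (2 * (h + 1) + c) +
      e * (Nat.card F - 1) * (Nat.card F : ℝ) ^ (h + 1 + c))
    (hpos : 0 < (Nat.card F : ℝ) ^ h + e)
    (ih : 2 * (Nat.card F : ℝ) ^ h * formCount F (Fin (2 * h + c) → F) (Nat.card F ^ c) z =
      evenRankCount (Nat.card F) (2 * h + c) h * ((Nat.card F : ℝ) ^ h + e)) :
    2 * (Nat.card F : ℝ) ^ (h + 1) *
        formCount F (Fin (2 * (h + 1) + c) → F) (Nat.card F ^ c) z' =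
      evenRankCount (Nat.card F) (2 * (h + 1) + c) (h + 1) * ((Nat.card F : ℝ) ^ (h + 1) + e) := by
  have hq := one_lt_card_real F
  have hq0 : (0 : ℝ) < Nat.card F := by linarith
  have hz0 : (z' : ℝ) = Nat.card F * z + (Nat.card F - 1) * (Nat.card F : ℝ) ^ (2 * h + c) := by
    apply mul_left_cancel₀ hq0.ne'
    rw [hz', hz]
    ring
  have hpos' : 0 < (Nat.card F : ℝ) ^ (h + 1) - e := by
    have := pow_sub_one_pos hq h
    nlinarith [sq_nonneg (e - 1)]
  -- The number of singular vectors outside the radical factors. One factor carries the induction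
  -- hypothesis to the next level; the other cancels against `e1` below.
  have hd' : (Nat.card F : ℝ) * (z' - ((Nat.card F ^ c : ℕ) : ℝ)) = (Nat.card F : ℝ) ^ (c + 1) *
      ((Nat.card F : ℝ) ^ (h + 1) - e) * ((Nat.card F : ℝ) ^ h + e) := by
    rw [mul_sub, hz']
    push_cast
    linear_combination (Nat.card F : ℝ) ^ (c + 1) * he
  have hdp : 0 < (Nat.card F : ℝ) ^ (c + 1) * ((Nat.card F : ℝ) ^ (h + 1) - e) *
      ((Nat.card F : ℝ) ^ h + e) := by positivity
  have hd : Nat.card F ^ c ≤ z' := by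
    rw [← hd'] at hdp
    have := sub_pos.1 (pos_of_mul_pos_right hdp hq0.le)
    exact_mod_cast this.le
  have H := formCount_singular_real hz0 hd
  have hG := evenRankCount_add_two hq (2 * h + c) h
  have e0 : 2 * (h + 1) + c = 2 * h + c + 2 := by ring
  rw [e0]
  have e1 : (Nat.card F : ℝ) ^ (2 * h + 2) - 1 =
      ((Nat.card F : ℝ) ^ (h + 1) - e) * ((Nat.card F : ℝ) ^ (h + 1) + e) := by
    linear_combination he
  rw [e1] at hG
  apply mul_right_cancel₀ hdp.ne'
  rw [← hd']
  set q : ℝ := ((Nat.card F : ℕ) : ℝ)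
  set N' : ℝ := (formCount F (Fin (2 * h + c + 2) → F) (Nat.card F ^ c) z' : ℝ)
  set N : ℝ := (formCount F (Fin (2 * h + c) → F) (Nat.card F ^ c) z : ℝ)
  set G := evenRankCount q (2 * h + c) h
  set G' := evenRankCount q (2 * h + c + 2) (h + 1)
  calc 2 * q ^ (h + 1) * N' * (q * (z' - ((Nat.card F ^ c : ℕ) : ℝ)))
      = 2 * q ^ (h + 2) * (N' * (z' - ((Nat.card F ^ c : ℕ) : ℝ))) := by ring
    _ = (2 * q ^ h * N) * ((q ^ (2 * h + c + 2) - 1) * (q ^ (2 * h + c + 1) - 1) *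
          q ^ (2 * h + c + 3)) := by rw [H]; ring
    _ = (G * ((q ^ (2 * h + c + 2) - 1) * (q ^ (2 * h + c + 1) - 1) * q ^ (2 * h + 2))) *
          (q ^ h + e) * q ^ (c + 1) := by rw [ih]; ring
    _ = G' * (q ^ (h + 1) + e) * (q * (z' - ((Nat.card F ^ c : ℕ) : ℝ))) := by
      rw [← hG, hd']; ring

/-- The number of quadratic forms with `h` hyperbolic planes and a radical of dimension `c`. -/
theorem formCount_plus (c h z : ℕ) (hz : (Nat.card F : ℝ) * z =
      (Nat.card F : ℝ) ^ (2 * h + c) + (Nat.card F - 1) * (Nat.card F : ℝ) ^ (h + c)) :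
    2 * (Nat.card F : ℝ) ^ h * formCount F (Fin (2 * h + c) → F) (Nat.card F ^ c) z =
      evenRankCount (Nat.card F) (2 * h + c) h * ((Nat.card F : ℝ) ^ h + 1) := by
  have hq := one_lt_card_real F
  induction h generalizing z with
  | zero =>
    have h1 : z = Nat.card F ^ c := by
      have : (z : ℝ) = (Nat.card F : ℝ) ^ c := by
        apply mul_left_cancel₀ (zero_lt_one.trans hq).ne'
        rw [hz, mul_zero, zero_add]
        ring
      exact_mod_cast this
    rw [mul_zero, zero_add, h1, formCount_zero_form]
    simp [evenRankCount]
    norm_num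
  | succ h ih =>
    -- The zero count of the smaller form must be a natural number. Division by q is visible when h
    -- + c > 0; for h + c = 0 the space is zero and has one zero.
    obtain ⟨z0, hz0⟩ : ∃ z0 : ℕ, (Nat.card F : ℝ) * z0 =
        (Nat.card F : ℝ) ^ (2 * h + c) + (Nat.card F - 1) * (Nat.card F : ℝ) ^ (h + c) := by
      rcases Nat.eq_zero_or_pos (h + c) with h0 | h0
      · obtain ⟨rfl, rfl⟩ : h = 0 ∧ c = 0 := by omega
        exact ⟨1, by simp⟩
      · obtain ⟨j, hj⟩ : ∃ j, h + c = j + 1 := ⟨h + c - 1, by omega⟩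
        refine ⟨Nat.card F ^ (h + j) + (Nat.card F - 1) * Nat.card F ^ j, ?_⟩
        have : 2 * h + c = h + j + 1 := by omega
        rw [this, hj]
        push_cast [Nat.cast_pred (Nat.card_pos (α := F))]
        ring
    exact formCount_hyperbolic_plane (one_pow 2) (by rw [hz0]; ring) (by rw [hz]; ring)
      (by positivity) (ih z0 hz0)

/-- In one variable every nonzero form is anisotropic, and there are q forms in total. -/
theorem formCount_one_dim : (formCount F (Fin 1 → F) 1 1 : ℝ) = Nat.card F - 1 := by
  have h := card_ne (QuadraticForm F (Fin 1 → F)) 0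
  rw [card_quadraticForm] at h
  have hq := two_le_card F
  have h1 : formCount F (Fin 1 → F) 1 1 = Nat.card {Q : QuadraticForm F (Fin 1 → F) // Q ≠ 0} := by
    refine Nat.card_congr (Equiv.subtypeEquivRight fun Q => ?_)
    constructor
    · rintro ⟨h, -⟩ rfl
      rw [radCount_zero, card_fin_fun, pow_one] at h
      omega
    · intro hQ
      obtain ⟨h, c, H⟩ := quadraticForm_classification 1 Q
      rcases H with ⟨h1, h2, h3⟩ | ⟨h1, h2, h3, h4⟩ | ⟨h1, h2, h3⟩
      · obtain ⟨rfl, rfl⟩ : h = 0 ∧ c = 1 := by omega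
        refine absurd ((zeroCount_eq_card Q).1 ?_) hQ
        rw [card_fin_fun]
        apply Nat.eq_of_mul_eq_mul_left (n := Nat.card F) (by omega)
        rw [h3]
        obtain ⟨s, hs⟩ : ∃ s, Nat.card F = s + 1 := ⟨Nat.card F - 1, by omega⟩
        rw [hs, Nat.add_sub_cancel]
        ring
      · omega
      · obtain ⟨rfl, rfl⟩ : h = 0 ∧ c = 0 := by omega
        refine ⟨by simpa using h2, ?_⟩
        apply Nat.eq_of_mul_eq_mul_left (n := Nat.card F) (by omega)
        simpa using h3
  rw [h1, h, Nat.cast_pred (by positivity)]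
  simp

/-- Partition of all quadratic forms according to the sizes of the radical and the zero set. -/
theorem card_quadraticForm_eq_sum {n : ℕ} (S : Finset (ℕ × ℕ))
    (hS : ∀ Q : QuadraticForm F (Fin n → F), (radCount Q, zeroCount Q) ∈ S) :
    Nat.card (QuadraticForm F (Fin n → F)) =
      ∑ p ∈ S, formCount F (Fin n → F) p.1 p.2 := by
  classical
  have := Fintype.ofFinite (QuadraticForm F (Fin n → F))
  rw [Nat.card_eq_fintype_card, ← Finset.card_univ,
    Finset.card_eq_sum_card_fiberwise (f := fun Q => (radCount Q, zeroCount Q)) (t := S)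
      (fun Q _ => hS Q)]
  refine Finset.sum_congr rfl fun p _ => ?_
  rw [formCount, Nat.card_eq_fintype_card, Fintype.card_subtype]
  congr 1
  ext Q
  simp [Prod.ext_iff]

/-- No recursion reaches this case, since there is no nonzero singular vector to remove. It is found
by subtraction: of the q^3 binary forms, the zero form, the q^2 - 1 forms of rank one and the
hyperbolic ones are already counted. -/
theorem formCount_anisotropic_plane :
    2 * (formCount F (Fin 2 → F) 1 1 : ℝ) = Nat.card F * ((Nat.card F : ℝ) - 1) ^ 2 := by
  have hq := two_le_card F
  have hqr := one_lt_card_real F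
  have hS := card_quadraticForm_eq_sum (F := F) (n := 2)
    {(Nat.card F ^ 2, Nat.card F ^ 2), (Nat.card F ^ 1, Nat.card F * 1), (1, 2 * Nat.card F - 1),
      (1, 1)} (fun Q => by
      obtain ⟨s, hs⟩ : ∃ s, Nat.card F = s + 1 := ⟨Nat.card F - 1, by omega⟩
      obtain ⟨h, c, H⟩ := quadraticForm_classification 2 Q
      rw [hs] at H ⊢
      simp only [Nat.add_sub_cancel] at H
      simp only [Finset.mem_insert, Finset.mem_singleton, Prod.mk.injEq]
      rcases H with ⟨h1, h2, h3⟩ | ⟨h1, h2, h3, h4⟩ | ⟨h1, h2, h3⟩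
      · rcases Nat.eq_zero_or_pos h with h0 | h0
        · obtain ⟨rfl, rfl⟩ : h = 0 ∧ c = 2 := by omega
          refine Or.inl ⟨h2, Nat.eq_of_mul_eq_mul_left (n := s + 1) (by omega) ?_⟩
          rw [h3]; ring
        · obtain ⟨rfl, rfl⟩ : h = 1 ∧ c = 0 := by omega
          refine Or.inr (Or.inr (Or.inl ⟨h2, Nat.eq_of_mul_eq_mul_left (n := s + 1) (by omega) ?_⟩))
          have : 2 * (s + 1) - 1 = 2 * s + 1 := by omega
          rw [h3, this]; ring
      · obtain ⟨rfl, rfl⟩ : h = 1 ∧ c = 0 := by omega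
        refine Or.inr (Or.inr (Or.inr ⟨h3, Nat.eq_of_mul_eq_mul_left (n := s + 1) (by omega) ?_⟩))
        linear_combination h4
      · obtain ⟨rfl, rfl⟩ : h = 0 ∧ c = 1 := by omega
        refine Or.inr (Or.inl ⟨h2, Nat.eq_of_mul_eq_mul_left (n := s + 1) (by omega) ?_⟩)
        rw [h3]; ring)
  have h12 : Nat.card F < Nat.card F ^ 2 := by nlinarith
  rw [card_quadraticForm, Finset.sum_insert, Finset.sum_insert, Finset.sum_insert,
    Finset.sum_singleton, formCount_zero_form] at hS
  rotate_left
  · simp only [Finset.mem_singleton, Prod.mk.injEq]; omega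
  · simp only [Finset.mem_insert, Finset.mem_singleton, Prod.mk.injEq, pow_one]; omega
  · simp only [Finset.mem_insert, Finset.mem_singleton, Prod.mk.injEq, pow_one]; omega
  have hS := congrArg (Nat.cast (R := ℝ)) hS
  push_cast at hS
  have h1 := formCount_radical_real (F := F) 1 0 1
  rw [pow_zero, formCount_one_dim] at h1
  have h2 := formCount_plus (F := F) 0 1 (2 * Nat.card F - 1) (by
    rw [Nat.cast_sub (by omega)]
    push_cast
    ring)
  simp only [evenRankCount, Finset.prod_range_one, rankFactor, pow_zero] at h2
  norm_num at h1 h2 hS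
  set q : ℝ := ((Nat.card F : ℕ) : ℝ)
  have hq1 : q - 1 ≠ 0 := by linarith
  have hq2 : q ^ 2 - 1 ≠ 0 := by nlinarith
  have h1' : (formCount F (Fin 2 → F) (Nat.card F) (Nat.card F) : ℝ) = q ^ 2 - 1 :=
    h1.resolve_right hq1
  have h2' : 2 * (formCount F (Fin 2 → F) 1 (2 * Nat.card F - 1) : ℝ) = q * (q ^ 2 - 1) := by
    apply mul_left_cancel₀ (show q ≠ 0 by linarith)
    rw [← mul_assoc, mul_comm q 2, h2]
    field_simp
    ring
  rw [h1'] at hS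
  linear_combination -2 * hS - h2'

/-- The number of quadratic forms with an anisotropic plane, `h` hyperbolic planes and a radical
of dimension `c`. -/
theorem formCount_minus (c h z : ℕ) (hz : (Nat.card F : ℝ) * z =
      (Nat.card F : ℝ) ^ (2 * (h + 1) + c) - (Nat.card F - 1) * (Nat.card F : ℝ) ^ (h + 1 + c)) :
    2 * (Nat.card F : ℝ) ^ (h + 1) *
        formCount F (Fin (2 * (h + 1) + c) → F) (Nat.card F ^ c) z =
      evenRankCount (Nat.card F) (2 * (h + 1) + c) (h + 1) *
        ((Nat.card F : ℝ) ^ (h + 1) - 1) := by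
  have hq := one_lt_card_real F
  have hq0 := zero_lt_one.trans hq
  induction h generalizing z with
  | zero =>
    have h1 : z = Nat.card F ^ c := by
      have : (z : ℝ) = (Nat.card F : ℝ) ^ c := by
        apply mul_left_cancel₀ hq0.ne'
        rw [hz]
        ring
      exact_mod_cast this
    have hG : ∀ c, evenRankCount (Nat.card F) (2 * (0 + 1) + c) (0 + 1) *
        ((Nat.card F : ℝ) ^ 2 - 1) = ((Nat.card F : ℝ) ^ (c + 2) - 1) *
          ((Nat.card F : ℝ) ^ (c + 1) - 1) * (Nat.card F : ℝ) ^ 2 := fun c => by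
      have := evenRankCount_add_two hq c 0
      rw [show 2 * (0 + 1) + c = c + 2 by ring]
      simpa [evenRankCount] using this
    have hq2 : (Nat.card F : ℝ) ^ 2 - 1 ≠ 0 := (pow_sub_one_pos hq 1).ne'
    subst h1
    clear hz
    apply mul_right_cancel₀ hq2
    rw [mul_right_comm (evenRankCount _ _ _), hG]
    -- With a single anisotropic plane, the radical is built up one dimension at a time by
    -- `formCount_radical_real`.
    induction c with
    | zero =>
      have := formCount_anisotropic_plane (F := F)
      norm_num
      linear_combination (Nat.card F : ℝ) * ((Nat.card F : ℝ) ^ 2 - 1) * this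
    | succ c ih =>
      have h1 := formCount_radical_real (F := F) (2 * (0 + 1) + c) c (Nat.card F ^ c)
      rw [← pow_succ'] at h1
      have e1 : 2 * (0 + 1) + (c + 1) = 2 * (0 + 1) + c + 1 := by ring
      have e2 : 2 * (0 + 1) + c + 1 = c + 3 := by ring
      rw [e1]
      apply mul_right_cancel₀ (pow_sub_one_pos hq c).ne'
      have e3 : (Nat.card F : ℝ) ^ (2 * (0 + 1) + c + 1) = (Nat.card F : ℝ) ^ (c + 3) := by rw [e2]
      rw [e3] at h1
      linear_combination (2 * (Nat.card F : ℝ) ^ (0 + 1) * ((Nat.card F : ℝ) ^ 2 - 1)) * h1 +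
        ((Nat.card F : ℝ) ^ (c + 3) - 1) * ih
  | succ h ih =>
    obtain ⟨z0, hz0⟩ : ∃ z0 : ℕ, (Nat.card F : ℝ) * z0 = (Nat.card F : ℝ) ^ (2 * (h + 1) + c) -
        (Nat.card F - 1) * (Nat.card F : ℝ) ^ (h + 1 + c) := by
      refine ⟨Nat.card F ^ (h + c) * (Nat.card F ^ (h + 1) - (Nat.card F - 1)), ?_⟩
      have h1 : Nat.card F - 1 ≤ Nat.card F ^ (h + 1) :=
        (Nat.sub_le _ _).trans (Nat.le_self_pow (Nat.succ_ne_zero h) _)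
      push_cast [Nat.cast_sub h1, Nat.cast_pred (Nat.card_pos (α := F))]
      ring
    -- The parameter is h + 1, so q^(h+1) - 1 > 0 as required; at exponent 0 it would vanish.
    have := formCount_hyperbolic_plane (F := F) (e := -1) (by norm_num) (c := c) (h := h + 1)
      (z := z0) (z' := z) (by rw [hz0]; ring) (by rw [hz]; ring)
      (by have := pow_sub_one_pos hq h; linarith) (by rw [ih z0 hz0]; ring)
    rw [this]
    ring

end RankCount

/-! ### Estimates and log-concavity of the explicit counts. -/

section Inequalities

/-- The two differences are at least q^3 - 1 and 3, and the fraction is at least 1. The q^3 is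
needed where a branch meets the odd-rank term. -/
theorem rankFactor_ge {q : ℝ} (hq : 2 ≤ q) {n i : ℕ} (hi : 2 * i + 3 ≤ n) :
    2 * q ^ 3 ≤ rankFactor q n i := by
  have h1 : q ^ 3 ≤ q ^ (n - 2 * i) := pow_le_pow_right₀ (by linarith) (by omega)
  have h2 : q ^ 2 ≤ q ^ (n - 2 * i - 1) := pow_le_pow_right₀ (by linarith) (by omega)
  have h3 := pow_sub_one_pos (show 1 < q by linarith) (2 * i + 1)
  have h4 : 1 ≤ q ^ (2 * i + 2) / (q ^ (2 * i + 2) - 1) := by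
    rw [one_le_div h3]
    linarith
  have h5 : 8 ≤ q ^ 3 := by
    calc (8 : ℝ) = 2 ^ 3 := by norm_num
      _ ≤ q ^ 3 := by gcongr
  have h6 : 4 ≤ q ^ 2 := by nlinarith
  have h7 : 2 * q ^ 3 ≤ (q ^ (n - 2 * i) - 1) * (q ^ (n - 2 * i - 1) - 1) := by
    calc 2 * q ^ 3 ≤ (q ^ 3 - 1) * (4 - 1) := by linarith
      _ ≤ (q ^ (n - 2 * i) - 1) * (q ^ (n - 2 * i - 1) - 1) := by
        apply mul_le_mul <;> linarith
  rw [rankFactor]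
  exact h7.trans (le_mul_of_one_le_right ((show 0 ≤ 2 * q ^ 3 by positivity).trans h7) h4)

/-- Each difference at least doubles when i decreases by one, and x/(x - 1) is decreasing in x. The
spare factor 4 pays for the plus sign in `signedRankCount_mul_le`. -/
theorem rankFactor_succ_le {q : ℝ} (hq : 2 ≤ q) {n i : ℕ} (hi : 2 * i + 5 ≤ n) :
    4 * rankFactor q n (i + 1) ≤ rankFactor q n i := by
  obtain ⟨c, rfl⟩ : ∃ c, n = 2 * i + c + 5 := ⟨n - 2 * i - 5, by omega⟩
  have e1 : 2 * i + c + 5 - 2 * (i + 1) = c + 3 := by omega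
  have e2 : 2 * i + c + 5 - 2 * i = c + 5 := by omega
  have hq1 : 1 < q := by linarith
  rw [rankFactor, rankFactor, e1, e2, Nat.add_sub_cancel (m := 1) (n := c + 4),
    Nat.add_sub_cancel (m := 1) (n := c + 2)]
  have a1 := pow_sub_one_pos hq1 (c + 2)
  have a2 := pow_sub_one_pos hq1 (c + 1)
  have a3 := pow_sub_one_pos hq1 (2 * i + 1)
  have a4 := pow_sub_one_pos hq1 (2 * (i + 1) + 1)
  have h1 : 2 * (q ^ (c + 3) - 1) ≤ q ^ (c + 5) - 1 := by
    have : q ^ (c + 5) = q ^ (c + 3) * q ^ 2 := by ring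
    have : 2 * q ^ (c + 3) ≤ q ^ (c + 5) := by
      rw [this, mul_comm]
      gcongr
      nlinarith
    linarith
  have h2 : 2 * (q ^ (c + 2) - 1) ≤ q ^ (c + 4) - 1 := by
    have : q ^ (c + 4) = q ^ (c + 2) * q ^ 2 := by ring
    have : 2 * q ^ (c + 2) ≤ q ^ (c + 4) := by
      rw [this, mul_comm]
      gcongr
      nlinarith
    linarith
  have h3 : q ^ (2 * (i + 1) + 2) / (q ^ (2 * (i + 1) + 2) - 1) ≤
      q ^ (2 * i + 2) / (q ^ (2 * i + 2) - 1) := by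
    rw [div_le_div_iff₀ a4 a3]
    have : q ^ (2 * i + 2) ≤ q ^ (2 * (i + 1) + 2) := pow_le_pow_right₀ hq1.le (by omega)
    linarith
  calc 4 * ((q ^ (c + 3) - 1) * (q ^ (c + 2) - 1) *
        (q ^ (2 * (i + 1) + 2) / (q ^ (2 * (i + 1) + 2) - 1)))
      = (2 * (q ^ (c + 3) - 1)) * (2 * (q ^ (c + 2) - 1)) *
        (q ^ (2 * (i + 1) + 2) / (q ^ (2 * (i + 1) + 2) - 1)) := by ring
    _ ≤ _ := by
      refine mul_le_mul (mul_le_mul h1 h2 (by linarith) (by linarith)) h3 ?_ ?_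
      · exact div_nonneg (by positivity) a4.le
      · exact mul_nonneg (by linarith) (by linarith)

theorem evenRankCount_pos {q : ℝ} (hq : 2 ≤ q) {n h : ℕ} (hh : 2 * h + 1 ≤ n) :
    0 < evenRankCount q n h := by
  refine Finset.prod_pos fun i hi => lt_of_lt_of_le (by positivity) (rankFactor_ge hq ?_)
  have := Finset.mem_range.1 hi
  omega

/-- Successive ratios are at least 4, so the sum is dominated by a geometric series with sum 4/3. -/
theorem sum_evenRankCount_le {q : ℝ} (hq : 2 ≤ q) {n h : ℕ} (hh : 2 * h + 1 ≤ n) :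
    ∑ i ∈ Finset.range (h + 1), evenRankCount q n i ≤ 4 / 3 * evenRankCount q n h := by
  induction h with
  | zero => simp [evenRankCount]; norm_num
  | succ h ih =>
    rw [Finset.sum_range_succ]
    have h1 := ih (by omega)
    have h2 := rankFactor_ge hq (n := n) (i := h) (by omega)
    have h3 := evenRankCount_pos hq (n := n) (h := h) (by omega)
    have h4 : 4 ≤ rankFactor q n h := by
      have : 2 ≤ q ^ 3 := hq.trans (le_self_pow₀ (by linarith) (by norm_num))
      linarith
    rw [evenRankCount_succ]
    nlinarith

theorem evenRankCount_top_succ {q : ℝ} (hq : 2 ≤ q) (k : ℕ) :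
    evenRankCount q (2 * (k + 1) + 1) (k + 1) =
      evenRankCount q (2 * k + 1) k * ((q ^ (2 * k + 3) - 1) * q ^ (2 * k + 2)) := by
  have h := evenRankCount_add_two (show 1 < q by linarith) (2 * k + 1) k
  have h1 := pow_sub_one_pos (show 1 < q by linarith) (2 * k + 1)
  apply mul_right_cancel₀ h1.ne'
  rw [show 2 * (k + 1) + 1 = 2 * k + 1 + 2 by ring, h]
  ring

theorem evenRankCount_top_le {q : ℝ} (hq : 2 ≤ q) (k : ℕ) :
    evenRankCount q (2 * k + 1) k ≤ q ^ (2 * k ^ 2 + 3 * k) := by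
  induction k with
  | zero => simp [evenRankCount]
  | succ k ih =>
    rw [evenRankCount_top_succ hq]
    have e : q ^ (2 * (k + 1) ^ 2 + 3 * (k + 1)) =
        q ^ (2 * k ^ 2 + 3 * k) * (q ^ (2 * k + 3) * q ^ (2 * k + 2)) := by ring
    rw [e]
    have h1 := pow_sub_one_pos (show 1 < q by linarith) (2 * k + 2)
    gcongr
    linarith

theorem le_evenRankCount_top {q : ℝ} (hq : 2 ≤ q) (k : ℕ) :
    q ^ (2 * k ^ 2 + 3 * k) ≤ 2 * evenRankCount q (2 * k + 1) k := by
  -- The bare factor 1/2 is not inductive; it is strengthened to (1 + q^(-2k))/2, whose decrease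
  -- absorbs the loss 1 - q^(-(2k+3)) at each step.
  have h : (q ^ (2 * k) + 1) * q ^ (2 * k ^ 2 + 3 * k) ≤
      2 * q ^ (2 * k) * evenRankCount q (2 * k + 1) k := by
    induction k with
    | zero => simp [evenRankCount]; norm_num
    | succ k ih =>
      rw [evenRankCount_top_succ hq]
      have h1 := pow_sub_one_pos (show 1 < q by linarith) (2 * k + 2)
      have h2 : 1 ≤ q ^ (2 * k) := one_le_pow₀ (by linarith)
      have h3 : q ^ 2 * q ≤ q ^ 5 - q ^ 3 := by
        have : q ^ 5 - q ^ 3 = q ^ 2 * q * (q ^ 2 - 1) := by ring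
        rw [this]
        exact le_mul_of_one_le_right (by positivity) (by nlinarith)
      have h4 : (q ^ (2 * k) * q ^ 2 + 1) * (q ^ (2 * k) * q ^ 3) ≤
          q ^ 2 * ((q ^ (2 * k) + 1) * (q ^ (2 * k) * q ^ 3 - 1)) := by
        have h5 : q ^ 2 * 2 ≤ q ^ 5 - q ^ 3 := (by gcongr : q ^ 2 * 2 ≤ q ^ 2 * q).trans h3
        have h6 : 0 < q ^ 2 := by positivity
        nlinarith
      calc (q ^ (2 * (k + 1)) + 1) * q ^ (2 * (k + 1) ^ 2 + 3 * (k + 1))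
          = ((q ^ (2 * k) * q ^ 2 + 1) * (q ^ (2 * k) * q ^ 3)) *
              (q ^ (2 * k ^ 2 + 3 * k) * q ^ (2 * k + 2)) := by ring
        _ ≤ (q ^ 2 * ((q ^ (2 * k) + 1) * (q ^ (2 * k) * q ^ 3 - 1))) *
              (q ^ (2 * k ^ 2 + 3 * k) * q ^ (2 * k + 2)) := by gcongr
        _ = ((q ^ (2 * k) + 1) * q ^ (2 * k ^ 2 + 3 * k)) *
              (q ^ 2 * ((q ^ (2 * k + 3) - 1) * q ^ (2 * k + 2))) := by ring
        _ ≤ (2 * q ^ (2 * k) * evenRankCount q (2 * k + 1) k) *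
              (q ^ 2 * ((q ^ (2 * k + 3) - 1) * q ^ (2 * k + 2))) := by gcongr
        _ = _ := by ring
  have h0 : 0 < q ^ (2 * k) := by positivity
  have h1 : 0 < q ^ (2 * k ^ 2 + 3 * k) := by positivity
  apply le_of_mul_le_mul_left _ h0
  linarith

/-- The number of forms of rank `2 h` and sign `e` in `n` variables. -/
noncomputable def signedRankCount (q e : ℝ) (n h : ℕ) : ℝ :=
  evenRankCount q n h * (q ^ h + e) / (2 * q ^ h)

/-- The number of forms of odd rank in `2 k + 1` variables. -/
noncomputable def oddRankCount (q : ℝ) (k : ℕ) : ℝ :=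
  q ^ (2 * k ^ 2 + 3 * k + 1) - ∑ h ∈ Finset.range (k + 1), evenRankCount q (2 * k + 1) h

theorem oddRankCount_le {q : ℝ} (hq : 2 ≤ q) (k : ℕ) :
    oddRankCount q k ≤ 2 * q * evenRankCount q (2 * k + 1) k := by
  have h1 := le_evenRankCount_top hq k
  have h2 : 0 ≤ ∑ h ∈ Finset.range (k + 1), evenRankCount q (2 * k + 1) h :=
    Finset.sum_nonneg fun i hi => (evenRankCount_pos hq (by
      have := Finset.mem_range.1 hi
      omega)).le
  have h3 : q ^ (2 * k ^ 2 + 3 * k + 1) = q * q ^ (2 * k ^ 2 + 3 * k) := by ring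
  rw [oddRankCount, h3]
  nlinarith

/-- All forms number at least qE ≥ 2E and those of even rank at most 4E/3, with E the top even-rank
count; 2E/3 remains. -/
theorem le_oddRankCount {q : ℝ} (hq : 2 ≤ q) (k : ℕ) :
    evenRankCount q (2 * k + 1) k / 2 ≤ oddRankCount q k := by
  have h1 := evenRankCount_top_le hq k
  have h2 := sum_evenRankCount_le hq (le_refl (2 * k + 1))
  have h0 := evenRankCount_pos hq (le_refl (2 * k + 1))
  have h3 : q ^ (2 * k ^ 2 + 3 * k + 1) = q * q ^ (2 * k ^ 2 + 3 * k) := by ring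
  rw [oddRankCount, h3]
  nlinarith

theorem signedRankCount_mul_le {q e : ℝ} (hq : 2 ≤ q) (he : e = 1 ∨ e = -1) {n h : ℕ}
    (hh : 2 * (h + 2) + 1 ≤ n) :
    signedRankCount q e n h * signedRankCount q e n (h + 2) ≤
      signedRankCount q e n (h + 1) ^ 2 := by
  have hE := evenRankCount_pos hq (n := n) (h := h) (by omega)
  have r1 := rankFactor_ge hq (n := n) (i := h) (by omega)
  have r2 := rankFactor_ge hq (n := n) (i := h + 1) (by omega)
  have r3 := rankFactor_succ_le hq (n := n) (i := h) (by omega)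
  simp only [signedRankCount, evenRankCount_succ, pow_succ q]
  have hQ : 1 ≤ q ^ h := one_le_pow₀ (by linarith)
  generalize q ^ h = Q at *
  generalize rankFactor q n h = r at *
  generalize rankFactor q n (h + 1) = s at *
  generalize evenRankCount q n h = E at *
  have hs : 0 < s := lt_of_lt_of_le (by positivity) r2
  have hq0 : 0 < q := by linarith
  -- For e = 1 the factor 4 in `r3` is spent; for e = -1 the inequality without s and r already
  -- holds, the difference being Q (q - 1)^2.
  have key : s * ((Q + e) * (Q * q * q + e)) ≤ r * (Q * q + e) ^ 2 := by
    rcases he with rfl | rfl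
    · have h1 : (Q + 1) * (Q * q * q + 1) ≤ (2 * Q) * (2 * (Q * q * q)) := by
        have : 1 ≤ Q * q * q := by nlinarith [mul_self_nonneg q]
        gcongr <;> linarith
      have h2 : (2 * Q) * (2 * (Q * q * q)) ≤ 4 * (Q * q + 1) ^ 2 := by
        have : 0 < Q * q := by positivity
        nlinarith
      calc s * ((Q + 1) * (Q * q * q + 1)) ≤ s * (4 * (Q * q + 1) ^ 2) := by
            exact mul_le_mul_of_nonneg_left (h1.trans h2) hs.le
        _ = (4 * s) * (Q * q + 1) ^ 2 := by ring
        _ ≤ r * (Q * q + 1) ^ 2 := by gcongr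
    · have h1 : (Q + -1) * (Q * q * q + -1) ≤ (Q * q + -1) ^ 2 := by
        nlinarith [mul_nonneg (by linarith : 0 ≤ Q) (sq_nonneg (q - 1))]
      calc s * ((Q + -1) * (Q * q * q + -1)) ≤ s * (Q * q + -1) ^ 2 := by gcongr
        _ ≤ r * (Q * q + -1) ^ 2 := by gcongr; linarith
  have e1 : E * (Q + e) / (2 * Q) * (E * r * s * (Q * q * q + e) / (2 * (Q * q * q))) =
      (E ^ 2 * r / (4 * Q ^ 2 * q ^ 2)) * (s * ((Q + e) * (Q * q * q + e))) := by
    field_simp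
    ring
  have e2 : (E * r * (Q * q + e) / (2 * (Q * q))) ^ 2 =
      (E ^ 2 * r / (4 * Q ^ 2 * q ^ 2)) * (r * (Q * q + e) ^ 2) := by
    field_simp
    ring
  rw [e1, e2]
  have : 0 < r := by linarith
  gcongr

/-- The odd-rank count exceeds the neighbouring even one by a factor of at most 2q, while the
preceding ratio r is at least 2q^3. -/
theorem signedRankCount_mul_oddRankCount_le {q e : ℝ} (hq : 2 ≤ q) (he : e = 1 ∨ e = -1) (k : ℕ) :
    signedRankCount q e (2 * (k + 1) + 1) k * oddRankCount q (k + 1) ≤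
      signedRankCount q e (2 * (k + 1) + 1) (k + 1) ^ 2 := by
  have hE := evenRankCount_pos hq (n := 2 * (k + 1) + 1) (h := k) (by omega)
  have r1 := rankFactor_ge hq (n := 2 * (k + 1) + 1) (i := k) (by omega)
  have hM := oddRankCount_le hq (k + 1)
  simp only [signedRankCount, evenRankCount_succ, pow_succ q] at hM ⊢
  have hQ : 1 ≤ q ^ k := one_le_pow₀ (by linarith)
  generalize q ^ k = Q at *
  generalize rankFactor q (2 * (k + 1) + 1) k = r at *
  generalize evenRankCount q (2 * (k + 1) + 1) k = E at *
  generalize oddRankCount q (k + 1) = M at *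
  have hq0 : 0 < q := by linarith
  have hr : 0 < r := lt_of_lt_of_le (by positivity) r1
  have hQe : 0 ≤ Q + e := by rcases he with rfl | rfl <;> linarith
  have key : 4 * q ^ 3 * Q * (Q + e) ≤ r * (Q * q + e) ^ 2 := by
    have h2 : 2 * (Q * (Q + e)) ≤ (Q * q + e) ^ 2 := by
      have h3 : 2 * Q ≤ Q * q := by nlinarith
      rcases he with rfl | rfl <;> nlinarith
    calc 4 * q ^ 3 * Q * (Q + e) = 2 * q ^ 3 * (2 * (Q * (Q + e))) := by ring
      _ ≤ r * (Q * q + e) ^ 2 := by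
        apply mul_le_mul r1 h2 _ hr.le
        positivity
  calc E * (Q + e) / (2 * Q) * M ≤ E * (Q + e) / (2 * Q) * (2 * q * (E * r)) := by gcongr
    _ = (E ^ 2 * r / (4 * Q ^ 2 * q ^ 2)) * (4 * q ^ 3 * Q * (Q + e)) := by
      field_simp
    _ ≤ (E ^ 2 * r / (4 * Q ^ 2 * q ^ 2)) * (r * (Q * q + e) ^ 2) := by gcongr
    _ = (E * r * (Q * q + e) / (2 * (Q * q))) ^ 2 := by
      field_simp
      ring

/-- The two neighbours of the middle multiply to (E/2)^2 (1 - q^(-2k)), and the middle term is at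
least E/2. -/
theorem signedRankCount_mul_neg_le {q : ℝ} (hq : 2 ≤ q) (k : ℕ) :
    signedRankCount q 1 (2 * k + 1) k * signedRankCount q (-1) (2 * k + 1) k ≤
      oddRankCount q k ^ 2 := by
  have hE := evenRankCount_pos hq (le_refl (2 * k + 1))
  have hM := le_oddRankCount hq k
  simp only [signedRankCount]
  have hQ : 1 ≤ q ^ k := one_le_pow₀ (by linarith)
  generalize q ^ k = Q at *
  generalize evenRankCount q (2 * k + 1) k = E at *
  calc E * (Q + 1) / (2 * Q) * (E * (Q + -1) / (2 * Q)) = (E / 2) ^ 2 - (E / (2 * Q)) ^ 2 := by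
        field_simp
        ring
    _ ≤ (E / 2) ^ 2 := by linarith [sq_nonneg (E / (2 * Q))]
    _ ≤ _ := by gcongr

/-- The numbers of quadratic forms in `2 k + 1` variables, ordered by weight. -/
noncomputable def weightSeq (q : ℝ) (k i : ℕ) : ℝ :=
  if i ≤ k then signedRankCount q 1 (2 * k + 1) i
  else if i = k + 1 then oddRankCount q k
  else signedRankCount q (-1) (2 * k + 1) (2 * k + 2 - i)

theorem weightSeq_logConcave {q : ℝ} (hq : 2 ≤ q) {k i : ℕ} (hk : 1 ≤ k) (hi : i + 2 < 2 * k + 2) :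
    weightSeq q k i * weightSeq q k (i + 2) ≤ weightSeq q k (i + 1) ^ 2 := by
  obtain ⟨k, rfl⟩ : ∃ j, k = j + 1 := ⟨k - 1, by omega⟩
  unfold weightSeq
  rcases lt_trichotomy (i + 1) (k + 2) with h | h | h
  · rcases lt_or_eq_of_le (show i ≤ k by omega) with h | rfl
    · rw [if_pos (by omega), if_pos (by omega), if_pos (by omega)]
      exact signedRankCount_mul_le hq (Or.inl rfl) (by omega)
    · rw [if_pos (by omega), if_neg (by omega), if_pos rfl, if_pos (by omega)]
      exact signedRankCount_mul_oddRankCount_le hq (Or.inl rfl) i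
  · obtain rfl : i = k + 1 := by omega
    rw [if_pos (by omega), if_neg (by omega), if_neg (by omega), if_neg (by omega), if_pos rfl,
      show 2 * (k + 1) + 2 - (k + 1 + 2) = k + 1 by omega]
    exact signedRankCount_mul_neg_le hq (k + 1)
  · rcases eq_or_lt_of_le (show k + 2 ≤ i by omega) with rfl | h
    -- On the minus branch h decreases as i grows, so the factors are swapped to reuse the same
    -- inequalities.
    · rw [if_neg (by omega), if_pos rfl, if_neg (by omega), if_neg (by omega), if_neg (by omega),
        if_neg (by omega), show 2 * (k + 1) + 2 - (k + 2 + 2) = k by omega,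
        show 2 * (k + 1) + 2 - (k + 2 + 1) = k + 1 by omega, mul_comm]
      exact signedRankCount_mul_oddRankCount_le hq (Or.inr rfl) k
    · obtain ⟨j, hj⟩ : ∃ j, 2 * (k + 1) + 2 - (i + 2) = j := ⟨_, rfl⟩
      rw [if_neg (by omega), if_neg (by omega), if_neg (by omega), if_neg (by omega),
        if_neg (by omega), if_neg (by omega), hj, show 2 * (k + 1) + 2 - i = j + 2 by omega,
        show 2 * (k + 1) + 2 - (i + 1) = j + 1 by omega, mul_comm]
      exact signedRankCount_mul_le hq (Or.inr rfl) (by omega)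

end Inequalities

/-! ### From counts of forms to the weight distribution of the code. -/

section WeightDistribution

/-- The surviving indices and the values of `w` are strictly increasing lists with the same members,
hence equal. -/
theorem filter_map_range_eq {A w : ℕ → ℕ} {N n : ℕ} (hmono : ∀ i j, i < j → j < n → w i < w j)
    (hN : ∀ i < n, w i < N) (hpos : ∀ i < n, A (w i) ≠ 0)
    (hsupp : ∀ x < N, A x ≠ 0 → ∃ i < n, w i = x) :
    ((List.range N).map A).filter (fun a => a ≠ 0) = (List.range n).map (fun i => A (w i)) := by
  rw [List.filter_map]
  have h : (List.range N).filter ((fun a => decide (a ≠ 0)) ∘ A) = (List.range n).map w := by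
    have h1 : ((List.range N).filter ((fun a => decide (a ≠ 0)) ∘ A)).Pairwise (· < ·) :=
      List.Pairwise.filter _ List.pairwise_lt_range
    have h2 : ((List.range n).map w).Pairwise (· < ·) := by
      rw [List.pairwise_map]
      refine List.Pairwise.imp_of_mem (fun {a b} _ hb hab => hmono a b hab (List.mem_range.1 hb))
        List.pairwise_lt_range
    refine List.Perm.eq_of_pairwise' h1 h2 ?_
    refine (List.perm_ext_iff_of_nodup (h1.imp fun h => h.ne) (h2.imp fun h => h.ne)).2 fun x => ?_
    simp only [List.mem_filter, List.mem_range, Function.comp_apply, decide_eq_true_eq,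
      List.mem_map]
    constructor
    · rintro ⟨hx, hA⟩
      exact hsupp x hx hA
    · rintro ⟨i, hi, rfl⟩
      exact ⟨hN i hi, hpos i hi⟩
  rw [h, List.map_map]
  rfl

variable {F : Type*} [Field F]

theorem mem_homogeneousReedMuller_two {m : ℕ} {c : (Fin m → F) → F} :
    c ∈ homogeneousReedMuller F 2 m ↔ ∃ Q : QuadraticForm F (Fin m → F), ⇑Q = c := by
  rw [homogeneousReedMuller, Submodule.mem_map]
  constructor
  · rintro ⟨f, hf, rfl⟩
    obtain ⟨Q, hQ⟩ := exists_quadraticForm_of_mem_homogeneousSubmodule_two hf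
    exact ⟨Q, funext fun x => by
      rw [← hQ x]
      simp [evalAllPoints, MvPolynomial.aeval_eq_eval]⟩
  · rintro ⟨Q, rfl⟩
    obtain ⟨f, hf, hQ⟩ := exists_homogeneous_of_quadraticForm Q
    exact ⟨f, hf, funext fun x => by
      rw [← hQ x]
      simp [evalAllPoints, MvPolynomial.aeval_eq_eval]⟩

theorem hammingNorm_add_zeroCount [Fintype F] [DecidableEq F] {m : ℕ}
    (Q : QuadraticForm F (Fin m → F)) :
    hammingNorm (⇑Q) + zeroCount Q = Nat.card F ^ m := by
  rw [← card_fin_fun, hammingNorm, zeroCount, Nat.card_eq_fintype_card, Nat.card_eq_fintype_card,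
    Fintype.card_subtype, add_comm, ← Finset.card_univ]
  exact Finset.card_filter_add_card_filter_not _

theorem weightCount_homogeneousReedMuller_two [Fintype F] [DecidableEq F] {m w z : ℕ}
    (hwz : w + z = Nat.card F ^ m) :
    weightCount (homogeneousReedMuller F 2 m) w =
      Nat.card {Q : QuadraticForm F (Fin m → F) // zeroCount Q = z} := by
  have hmem (Q : {Q : QuadraticForm F (Fin m → F) // zeroCount Q = z}) :
      ⇑Q.1 ∈ homogeneousReedMuller F 2 m ∧ hammingNorm ⇑Q.1 = w := by
    have := hammingNorm_add_zeroCount Q.1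
    have := Q.2
    exact ⟨mem_homogeneousReedMuller_two.2 ⟨Q.1, rfl⟩, by omega⟩
  rw [weightCount, ← Nat.card_coe_set_eq]
  refine (Nat.card_congr (Equiv.ofBijective (fun Q => ⟨⇑Q.1, hmem Q⟩) ⟨?_, ?_⟩)).symm
  · intro Q Q' h
    exact Subtype.ext (DFunLike.coe_injective (congrArg Subtype.val h))
  · rintro ⟨c, hc, hw⟩
    obtain ⟨Q, rfl⟩ := mem_homogeneousReedMuller_two.1 hc
    have := hammingNorm_add_zeroCount Q
    exact ⟨⟨Q, by omega⟩, rfl⟩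

/-- The possible numbers of zeros of a quadratic form in `2 k + 1` variables over a field with `q`
elements, in decreasing order. -/
def zeroSeq (q k i : ℕ) : ℕ :=
  if i ≤ k then q ^ (2 * k) + (q - 1) * q ^ (2 * k - i)
  else if i = k + 1 then q ^ (2 * k)
  else q ^ (2 * k) - (q - 1) * q ^ (i - 2)

/-- Shows that the truncated subtraction in the minus branch of `zeroSeq` is a true one. -/
theorem sub_one_mul_pow_lt {q a b : ℕ} (hq : 2 ≤ q) (hab : a < b) : (q - 1) * q ^ a < q ^ b := by
  calc (q - 1) * q ^ a < q * q ^ a := by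
        have : 0 < q ^ a := by positivity
        gcongr
        omega
    _ = q ^ (a + 1) := by ring
    _ ≤ q ^ b := Nat.pow_le_pow_right (by omega) hab

theorem zeroSeq_succ_lt {q k i : ℕ} (hq : 2 ≤ q) (hi : i + 1 < 2 * k + 2) :
    zeroSeq q k (i + 1) < zeroSeq q k i := by
  have hp : ∀ a, 0 < (q - 1) * q ^ a := fun a => Nat.mul_pos (by omega) (by positivity)
  have hlt : ∀ {a b}, a < b → (q - 1) * q ^ a < (q - 1) * q ^ b := fun h =>
    Nat.mul_lt_mul_of_pos_left (Nat.pow_lt_pow_right (by omega) h) (by omega)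
  unfold zeroSeq
  rcases lt_trichotomy i k with h | rfl | h
  · rw [if_pos (by omega), if_pos (by omega)]
    have := hlt (show 2 * k - (i + 1) < 2 * k - i by omega)
    omega
  · rw [if_neg (by omega), if_pos rfl, if_pos le_rfl]
    have := hp (2 * i - i)
    omega
  · have h1 := sub_one_mul_pow_lt hq (show i + 1 - 2 < 2 * k by omega)
    rcases eq_or_lt_of_le (show k + 1 ≤ i by omega) with rfl | h'
    · rw [if_neg (by omega), if_neg (by omega), if_neg (by omega), if_pos rfl]
      have := hp (k + 1 + 1 - 2)
      omega
    · rw [if_neg (by omega), if_neg (by omega), if_neg (by omega), if_neg (by omega)]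
      have := hlt (show i - 2 < i + 1 - 2 by omega)
      omega

theorem zeroSeq_strictAnti {q k : ℕ} (hq : 2 ≤ q) (i j : ℕ) (hij : i < j) (hj : j < 2 * k + 2) :
    zeroSeq q k j < zeroSeq q k i := by
  induction j, hij using Nat.le_induction with
  | base => exact zeroSeq_succ_lt hq hj
  | succ j _ ih => exact (zeroSeq_succ_lt hq hj).trans (ih (by omega))

theorem zeroSeq_le {q k : ℕ} (hq : 2 ≤ q) (i : ℕ) (hi : i < 2 * k + 2) :
    zeroSeq q k i ≤ q ^ (2 * k + 1) := by
  -- Index 0 is the zero form, which vanishes everywhere.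
  have h0 : zeroSeq q k 0 = q ^ (2 * k + 1) := by
    obtain ⟨s, rfl⟩ : ∃ s, q = s + 1 := ⟨q - 1, by omega⟩
    simp only [zeroSeq, Nat.zero_le, if_true, Nat.add_sub_cancel, Nat.sub_zero]
    ring
  rw [← h0]
  rcases Nat.eq_zero_or_pos i with rfl | h
  · exact le_rfl
  · exact (zeroSeq_strictAnti hq 0 i h hi).le

theorem mul_zeroSeq_plus {q k h c : ℕ} (hc : 2 * h + c = 2 * k + 1) :
    q * zeroSeq q k h = q ^ (2 * h + c) + (q - 1) * q ^ (h + c) := by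
  rw [zeroSeq, if_pos (by omega), hc, show h + c = 2 * k - h + 1 by omega]
  ring

theorem mul_zeroSeq_odd (q k : ℕ) : q * zeroSeq q k (k + 1) = q ^ (2 * k + 1) := by
  rw [zeroSeq, if_neg (by omega), if_pos rfl]
  ring

theorem mul_zeroSeq_minus {q k h c : ℕ} (hq : 2 ≤ q) (hh : 1 ≤ h) (hc : 2 * h + c = 2 * k + 1) :
    q * zeroSeq q k (2 * k + 2 - h) + (q - 1) * q ^ (h + c) = q ^ (2 * h + c) := by
  have h1 := sub_one_mul_pow_lt hq (show 2 * k + 2 - h - 2 < 2 * k by omega)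
  rw [zeroSeq, if_neg (by omega), if_neg (by omega), hc,
    show h + c = (2 * k + 2 - h - 2) + 1 by omega]
  obtain ⟨d, hd⟩ := Nat.exists_eq_add_of_le h1.le
  rw [pow_succ q (2 * k), hd, Nat.add_sub_cancel_left]
  ring

variable [Finite F]

theorem exists_zeroCount_eq_zeroSeq {k : ℕ} (Q : QuadraticForm F (Fin (2 * k + 1) → F)) :
    ∃ i < 2 * k + 2, zeroCount Q = zeroSeq (Nat.card F) k i := by
  have hq := two_le_card F
  obtain ⟨h, c, H⟩ := quadraticForm_classification _ Q
  rcases H with ⟨h1, h2, h3⟩ | ⟨h1, h2, h3, h4⟩ | ⟨h1, h2, h3⟩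
  · refine ⟨h, by omega, Nat.eq_of_mul_eq_mul_left (n := Nat.card F) (by omega) ?_⟩
    rw [h3, mul_zeroSeq_plus h1.symm, h1]
  · refine ⟨2 * k + 2 - h, by omega, Nat.eq_of_mul_eq_mul_left (n := Nat.card F) (by omega) ?_⟩
    have := mul_zeroSeq_minus hq h1 h2.symm
    rw [← h2] at this
    omega
  · refine ⟨k + 1, by omega, Nat.eq_of_mul_eq_mul_left (n := Nat.card F) (by omega) ?_⟩
    rw [h3, mul_zeroSeq_odd]

/-- The zero count already determines the radical: only plus type exceeds q^(n-1) zeros, and h + c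
together with 2h + c fixes c. So the condition on `radCount` can be dropped. -/
theorem card_zeroCount_plus {k h c z : ℕ} (hc : 2 * h + c = 2 * k + 1)
    (hz : Nat.card F * z = Nat.card F ^ (2 * h + c) + (Nat.card F - 1) * Nat.card F ^ (h + c)) :
    (Nat.card {Q : QuadraticForm F (Fin (2 * k + 1) → F) // zeroCount Q = z} : ℝ) =
      signedRankCount (Nat.card F) 1 (2 * k + 1) h := by
  have hq := two_le_card F
  have hp : ∀ a, 0 < (Nat.card F - 1) * Nat.card F ^ a := fun a =>
    Nat.mul_pos (by omega) (by positivity)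
  rw [← hc]
  have h1 : Nat.card {Q : QuadraticForm F (Fin (2 * h + c) → F) // zeroCount Q = z} =
      formCount F (Fin (2 * h + c) → F) (Nat.card F ^ c) z := by
    refine Nat.card_congr (Equiv.subtypeEquivRight fun Q => ⟨?_, fun h => h.2⟩)
    rintro rfl
    refine ⟨?_, rfl⟩
    obtain ⟨h', c', H⟩ := quadraticForm_classification _ Q
    rw [hz] at H
    have := hp (h + c)
    rcases H with ⟨h1, h2, h3⟩ | ⟨h1, h2, h3, h4⟩ | ⟨h1, h2, h3⟩
    · have h4 := Nat.pow_right_injective hq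
        (Nat.eq_of_mul_eq_mul_left (by omega) (Nat.add_left_cancel h3))
      rw [h2, show c' = c by omega]
    · omega
    · omega
  have hz' := congrArg (Nat.cast (R := ℝ)) hz
  push_cast [Nat.cast_pred (Nat.card_pos (α := F))] at hz'
  rw [h1, signedRankCount, ← formCount_plus c h z hz']
  field_simp

theorem card_zeroCount_minus {k h c z : ℕ} (hh : 1 ≤ h) (hc : 2 * h + c = 2 * k + 1)
    (hz : Nat.card F * z + (Nat.card F - 1) * Nat.card F ^ (h + c) = Nat.card F ^ (2 * h + c)) :
    (Nat.card {Q : QuadraticForm F (Fin (2 * k + 1) → F) // zeroCount Q = z} : ℝ) =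
      signedRankCount (Nat.card F) (-1) (2 * k + 1) h := by
  have hq := two_le_card F
  have hp : ∀ a, 0 < (Nat.card F - 1) * Nat.card F ^ a := fun a =>
    Nat.mul_pos (by omega) (by positivity)
  rw [← hc]
  have h1 : Nat.card {Q : QuadraticForm F (Fin (2 * h + c) → F) // zeroCount Q = z} =
      formCount F (Fin (2 * h + c) → F) (Nat.card F ^ c) z := by
    refine Nat.card_congr (Equiv.subtypeEquivRight fun Q => ⟨?_, fun h => h.2⟩)
    rintro rfl
    refine ⟨?_, rfl⟩
    obtain ⟨h', c', H⟩ := quadraticForm_classification _ Q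
    have := hp (h + c)
    have := hp (h' + c')
    rcases H with ⟨h1, h2, h3⟩ | ⟨h1, h2, h3, h4⟩ | ⟨h1, h2, h3⟩
    · omega
    · have h5 := Nat.pow_right_injective hq (Nat.eq_of_mul_eq_mul_left
        (show 0 < Nat.card F - 1 by omega) (Nat.add_left_cancel (h4.trans hz.symm)))
      rw [h3, show c' = c by omega]
    · omega
  have hz' := congrArg (Nat.cast (R := ℝ)) hz
  push_cast [Nat.cast_pred (Nat.card_pos (α := F))] at hz'
  obtain ⟨j, rfl⟩ : ∃ j, h = j + 1 := ⟨h - 1, by omega⟩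
  have H := formCount_minus (F := F) c j z (by linear_combination hz')
  rw [h1, signedRankCount, ← sub_eq_add_neg, ← H]
  field_simp

theorem card_quadraticForm_eq_sum_zeroSeq (k : ℕ) :
    Nat.card (QuadraticForm F (Fin (2 * k + 1) → F)) = ∑ i ∈ Finset.range (2 * k + 2),
      Nat.card {Q : QuadraticForm F (Fin (2 * k + 1) → F) //
        zeroCount Q = zeroSeq (Nat.card F) k i} := by
  classical
  have := Fintype.ofFinite (QuadraticForm F (Fin (2 * k + 1) → F))
  have hq := two_le_card F
  have hinj : Set.InjOn (zeroSeq (Nat.card F) k) (Finset.range (2 * k + 2)) := by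
    intro i hi j hj hij
    simp only [Finset.coe_range, Set.mem_Iio] at hi hj
    rcases lt_trichotomy i j with h | h | h
    · exact absurd hij (zeroSeq_strictAnti hq i j h hj).ne'
    · exact h
    · exact absurd hij (zeroSeq_strictAnti hq j i h hi).ne
  rw [Nat.card_eq_fintype_card, ← Finset.card_univ, Finset.card_eq_sum_card_fiberwise
    (f := zeroCount) (t := (Finset.range (2 * k + 2)).image (zeroSeq (Nat.card F) k)),
    Finset.sum_image hinj]
  · refine Finset.sum_congr rfl fun i _ => ?_
    exact (Fintype.card_subtype _).symm.trans Nat.card_eq_fintype_card.symm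
  · intro Q _
    obtain ⟨i, hi, h⟩ := exists_zeroCount_eq_zeroSeq Q
    rw [h]
    exact Finset.mem_coe.2 (Finset.mem_image_of_mem _ (Finset.mem_range.2 hi))

theorem signedRankCount_add_neg {q : ℝ} (hq : 2 ≤ q) (n h : ℕ) :
    signedRankCount q 1 n h + signedRankCount q (-1) n h = evenRankCount q n h := by
  have : q ^ h ≠ 0 := by positivity
  rw [signedRankCount, signedRankCount]
  field_simp
  ring

theorem two_le_card_real (F : Type*) [Field F] [Finite F] : (2 : ℝ) ≤ Nat.card F := by
  exact_mod_cast two_le_card F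

/-- The two signed branches are known directly; the middle value follows from the total number of
forms. -/
theorem card_zeroCount_eq_weightSeq {k i : ℕ} (hi : i < 2 * k + 2) :
    (Nat.card {Q : QuadraticForm F (Fin (2 * k + 1) → F) //
      zeroCount Q = zeroSeq (Nat.card F) k i} : ℝ) = weightSeq (Nat.card F) k i := by
  have hq := two_le_card F
  set N : ℕ → ℝ := fun i => (Nat.card {Q : QuadraticForm F (Fin (2 * k + 1) → F) //
    zeroCount Q = zeroSeq (Nat.card F) k i} : ℝ) with hN
  have hplus : ∀ i ≤ k, N i = signedRankCount (Nat.card F) 1 (2 * k + 1) i := fun i hi =>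
    card_zeroCount_plus (c := 2 * k + 1 - 2 * i) (by omega) (mul_zeroSeq_plus (by omega))
  have hminus : ∀ h, 1 ≤ h → h ≤ k →
      N (2 * k + 2 - h) = signedRankCount (Nat.card F) (-1) (2 * k + 1) h := fun h h1 h2 =>
    card_zeroCount_minus (c := 2 * k + 1 - 2 * h) h1 (by omega)
      (mul_zeroSeq_minus hq h1 (by omega))
  change N i = _
  rw [weightSeq]
  split_ifs with h1 h2
  · exact hplus i h1
  · subst h2
    have hs := congrArg (Nat.cast (R := ℝ)) (card_quadraticForm_eq_sum_zeroSeq (F := F) k)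
    have he : (2 * k + 1) * (2 * k + 1 + 1) / 2 = 2 * k ^ 2 + 3 * k + 1 := by
      rw [show (2 * k + 1) * (2 * k + 1 + 1) = (2 * k ^ 2 + 3 * k + 1) * 2 by ring]
      exact Nat.mul_div_cancel _ two_pos
    rw [Nat.cast_sum, card_quadraticForm, he, Nat.cast_pow] at hs
    change _ = ∑ i ∈ Finset.range (2 * k + 2), N i at hs
    rw [show 2 * k + 2 = (k + 1 + 1) + k by ring, Finset.sum_range_add, Finset.sum_range_succ,
      Finset.sum_congr rfl fun i hi => hplus i (by have := Finset.mem_range.1 hi; omega),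
      ← Finset.sum_range_reflect (fun x => N (k + 1 + 1 + x)) k] at hs
    have hm : ∑ j ∈ Finset.range k, N (k + 1 + 1 + (k - 1 - j)) =
        ∑ h ∈ Finset.range (k + 1), signedRankCount (Nat.card F) (-1) (2 * k + 1) h := by
      rw [Finset.sum_range_succ']
      -- There is no minus type of rank 0, and the formula agrees since q^0 - 1 = 0; both signs can
      -- thus be summed over the same range.
      have h0 : signedRankCount (Nat.card F) (-1) (2 * k + 1) 0 = 0 := by simp [signedRankCount]
      rw [h0, add_zero]
      refine Finset.sum_congr rfl fun j hj => ?_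
      have := Finset.mem_range.1 hj
      rw [← hminus (j + 1) (by omega) (by omega)]
      congr 1
      omega
    rw [hm] at hs
    rw [oddRankCount, hs, ← Finset.sum_congr rfl fun i _ =>
      signedRankCount_add_neg (two_le_card_real F) (2 * k + 1) i, Finset.sum_add_distrib]
    ring
  · rw [← hminus (2 * k + 2 - i) (by omega) (by omega)]
    congr 1
    omega

/-- All 2k + 2 candidate weights really occur, so filtering out zero terms neither removes an entry
nor changes who is adjacent. -/
theorem weightSeq_pos {q : ℝ} (hq : 2 ≤ q) {k i : ℕ} (hi : i < 2 * k + 2) :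
    0 < weightSeq q k i := by
  have hs : ∀ e h, 2 * h + 1 ≤ 2 * k + 1 → 0 < q ^ h + e → 0 < signedRankCount q e (2 * k + 1) h :=
    fun e h hh he => by
      have := evenRankCount_pos hq hh
      rw [signedRankCount]
      positivity
  rw [weightSeq]
  split_ifs with h1 h2
  · exact hs 1 i (by omega) (by positivity)
  · have := evenRankCount_pos hq (le_refl (2 * k + 1))
    exact lt_of_lt_of_le (by positivity) (le_oddRankCount hq k)
  · refine hs (-1) _ (by omega) ?_
    obtain ⟨j, hj⟩ : ∃ j, 2 * k + 2 - i = j + 1 := ⟨2 * k + 1 - i, by omega⟩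
    rw [hj]
    have := pow_sub_one_pos (show 1 < q by linarith) j
    linarith

omit [Finite F] in
theorem nonzeroWeightDistribution_homogeneousReedMuller_two [Fintype F] [DecidableEq F] (k : ℕ) :
    (nonzeroWeightDistribution (homogeneousReedMuller F 2 (2 * k + 1))).map (fun a : ℕ => (a : ℝ)) =
      (List.range (2 * k + 2)).map (weightSeq (Nat.card F) k) := by
  have hq := two_le_card F
  have hcount : ∀ i < 2 * k + 2, (weightCount (homogeneousReedMuller F 2 (2 * k + 1))
      (Nat.card F ^ (2 * k + 1) - zeroSeq (Nat.card F) k i) : ℝ) =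
        weightSeq (Nat.card F) k i := fun i hi => by
    rw [weightCount_homogeneousReedMuller_two (Nat.sub_add_cancel (zeroSeq_le hq i hi)),
      card_zeroCount_eq_weightSeq hi]
  have hcard : Fintype.card (Fin (2 * k + 1) → F) = Nat.card F ^ (2 * k + 1) := by
    rw [← Nat.card_eq_fintype_card, card_fin_fun]
  rw [nonzeroWeightDistribution, weightDistribution, hcard,
    filter_map_range_eq (w := fun i => Nat.card F ^ (2 * k + 1) - zeroSeq (Nat.card F) k i)
      (n := 2 * k + 2), List.map_map]
  · exact List.map_congr_left fun i hi => hcount i (List.mem_range.1 hi)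
  · intro i j hij hj
    have := zeroSeq_strictAnti hq i j hij hj
    have := zeroSeq_le hq i (hij.trans hj)
    omega
  · intro i _
    omega
  · intro i hi h0
    have := weightSeq_pos (two_le_card_real F) hi
    rw [← hcount i hi, h0] at this
    simp at this
  · intro w hw h0
    have hwz : w + (Nat.card F ^ (2 * k + 1) - w) = Nat.card F ^ (2 * k + 1) := by omega
    rw [weightCount_homogeneousReedMuller_two hwz] at h0
    obtain ⟨⟨Q, hQ⟩⟩ := (Nat.card_ne_zero.1 h0).1
    obtain ⟨i, hi, h⟩ := exists_zeroCount_eq_zeroSeq Q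
    exact ⟨i, hi, by omega⟩

end WeightDistribution

theorem mainTheorem7 (F : Type*) [Field F] [Fintype F] [DecidableEq F] (m : ℕ) (hm : 2 ≤ m)
    (hodd : Odd m) : IsLogConcaveCode (homogeneousReedMuller F 2 m) := by
  obtain ⟨k, rfl⟩ := hodd
  intro i hi
  simp only [nonzeroWeightDistribution_homogeneousReedMuller_two, List.length_map,
    List.length_range, List.getElem_map, List.getElem_range] at hi ⊢
  exact weightSeq_logConcave (two_le_card_real F) (by omega) hi
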